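/- For $x\in[0,1)$ let $a_n(x)=\lfloor 1/T^{n-1}(x)\rfloor$, $n\ge 1$, be the partial quotients of the regular continued fraction expansion of $x$, where $T(0)=0$ and $T(x)=1/x \bmod 1$ for $0<x<1$ is the Gauss map (if $x$ is rational, only finitely many partial quotients exist, and any product involving a non-existent partial quotient is taken to be $0$). Let $m\ge 1$ be an integer, let $\mathbf t=(t_0,\dots,t_{m-1})$ with all $t_i>0$ real, and let $\Psi:\mathbb N\to[1,\infty)$, where $\mathbb N=\{1,2,\dots\}$. Define $$\mathcal E_{\mathbf t}(\Psi)=\Big\{x\in[0,1):\ \prod_{i=0}^{m-1}a_{n+i}(x)^{t_i}\ge\Psi(n)\ \text{ for infinitely many } n\in\mathbb N\Big\},$$ and define $B,b\in[0,\infty]$ by $$\log B=\liminf_{n\to\infty}\frac{\log\Psi(n)}{n},\qquad \log b=\liminf_{n\to\infty}\frac{\log\log\Psi(n)}{n},$$ with the conventions $\log 0=-\infty$ and $\log\infty=\infty$. Then the Hausdorff dimension of the set satisfies $$\dim_{\mathrm H}\mathcal E_{\mathbf t}(\Psi)=\begin{cases}1 & \text{if } B=1,\\[1ex] \dfrac1{1+b}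 & \text{if } B=\infty,\end{cases}$$ where $\frac1{1+b}$ is read as $0$ when $b=\infty$. -/

import Mathlib

open Filter
open scoped ENNReal

noncomputable section

/-- The Gauss map `T 0 = 0`, `T x = 1 / x mod 1`. -/
def gaussMap (x : ℝ) : ℝ := Int.fract (1 / x)

/-- The `n`-th partial quotient `a n x = ⌊1 / T^(n-1) x⌋` of `x ∈ [0, 1)`, for `n ≥ 1`.
If `x` is rational, its expansion is finite, and the value is `0` past the last partial quotient
(since `1 / 0 = 0` here). -/
def partialQuotient (n : ℕ) (x : ℝ) : ℕ := ⌊1 / gaussMap^[n - 1] x⌋₊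

/-- The points `x ∈ [0, 1)` such that `a n x ^ t 0 * ⋯ * a (n + m - 1) x ^ t (m - 1) ≥ Ψ n`
for infinitely many `n ≥ 1`. -/
def weightedProductSet {m : ℕ} (t : Fin m → ℝ) (Ψ : ℕ → ℝ) : Set ℝ :=
  {x | x ∈ Set.Ico (0 : ℝ) 1 ∧
    {n : ℕ | 1 ≤ n ∧ Ψ n ≤ ∏ i : Fin m, (partialQuotient (n + i) x : ℝ) ^ t i}.Infinite}

/-- `B ∈ [0, ∞]`, given by `log B = liminf (log Ψ(n)) / n`. -/
def expGrowth (Ψ : ℕ → ℝ) : ℝ≥0∞ :=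
  EReal.exp (liminf (fun n : ℕ => ((Real.log (Ψ n) / n : ℝ) : EReal)) atTop)

/-- `b ∈ [0, ∞]`, given by `log b = liminf (log log Ψ(n)) / n`. The outer logarithm is the
extended one, with `log 0 = -∞`. -/
def doubleExpGrowth (Ψ : ℕ → ℝ) : ℝ≥0∞ :=
  EReal.exp (liminf (fun n : ℕ =>
    ENNReal.log (ENNReal.ofReal (Real.log (Ψ n))) / (n : EReal)) atTop)

end

/-!
Both dimension formulas are reduced to statements about single large digits.

**Lower bounds.** Since all digits are at least `1`, the product at `n` is at least
`a n ^ t 0`, so it suffices to make `a n` large infinitely often. Both constructions exhibit a map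
into the set, defined on a subset of `[0, 1)` of dimension `1`, whose inverse is Hölder of exponent
`s`; then the dimension is at least `s` (`le_dimH_of_inverse_holder`).

* If `B = 1`, then `Ψ n` is subexponential along a subsequence. The map adds `c n` to the `n`-th
  digit of an irrational number, where `c` is supported on a subsequence so sparse that
  `∏ (1 + c i)` is subexponential. Comparing continuants, distances shrink at most by the square of
  this product (`IsGaussOrbit.abs_sub_le_of_add`), whereas cylinders of length `n` shrink
  exponentially; so the Hölder exponent is as close to `1` as desired.
* If `B = ∞`, then `log (Ψ n) ≤ c ^ n` infinitely often for each `c > b`. The map sends the number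
  with mixed radix digits `d n < N n`, where `N n` is about `exp (c ^ n)`, to the continued fraction
  with digits `N n + d n`. As `N n` is about `(N 0 ⋯ N (n - 1)) ^ (c - 1)`, the exponent is any
  `s < 1 / (1 + c)` (`le_dimH_exp_pow_le_digit`).

**Upper bound for `B = ∞`.** A large weighted product contains a large digit. By a Borel–Cantelli
argument, the points with `a n ≥ exp (K n) (a 0 ⋯ a (n - 1)) ^ (lam - 1)` infinitely often have
dimension at most `s` if `s (1 + lam) > 1` and `K` is large
(`exists_dimH_frequently_large_digit_le`): the cylinder with these digits has diameter at most
`exp (- K n) (a 0 ⋯ a (n - 1)) ^ (- 1 - lam)`. With `lam = 1` this gives the bound `1 / 2`. If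
`b > 1`, then `log (a n) ≥ c ^ n` infinitely often, for any `c < b`, which forces
`log (a 0 ⋯ a n)` to grow by the factor `lam` infinitely often, for any `lam < c`
(`frequently_mul_add_le_of_pow_le`).
-/

/-! ### Infinite continued fractions as orbits of the Gauss map -/

/-- `a` is the sequence of partial quotients of `x 0` and `x n` is its `n`-th iterate under the
Gauss map, for an infinite continued fraction: `x n = 1 / (a n + x (n + 1))`. Digits are indexed
from `0` here, so `a n` is `partialQuotient (n + 1) (x 0)`. -/
structure IsGaussOrbit (a : ℕ → ℕ) (x : ℕ → ℝ) : Prop where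
  digit_pos : ∀ n, 1 ≤ a n
  pos : ∀ n, 0 < x n
  lt_one : ∀ n, x n < 1
  mul_eq : ∀ n, x n * (a n + x (n + 1)) = 1

namespace IsGaussOrbit

variable {a a' : ℕ → ℕ} {x x' y y' : ℕ → ℝ}

theorem one_div_eq (h : IsGaussOrbit a x) (n : ℕ) : 1 / x n = a n + x (n + 1) := by
  rw [div_eq_iff (h.pos n).ne', mul_comm, h.mul_eq]

theorem one_le_digit (h : IsGaussOrbit a x) (n : ℕ) : (1 : ℝ) ≤ a n := by
  exact_mod_cast h.digit_pos n

theorem gaussMap_eq (h : IsGaussOrbit a x) (n : ℕ) : gaussMap (x n) = x (n + 1) := by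
  rw [gaussMap, h.one_div_eq, Int.fract_natCast_add, Int.fract_eq_self]
  exact ⟨(h.pos _).le, h.lt_one _⟩

theorem iterate_eq (h : IsGaussOrbit a x) (n : ℕ) : gaussMap^[n] (x 0) = x n := by
  induction n with
  | zero => rfl
  | succ n ih => rw [Function.iterate_succ_apply', ih, h.gaussMap_eq]

theorem partialQuotient_eq (h : IsGaussOrbit a x) (n : ℕ) :
    partialQuotient (n + 1) (x 0) = a n := by
  rw [partialQuotient, Nat.add_sub_cancel, h.iterate_eq, h.one_div_eq,
    Nat.floor_eq_iff (add_nonneg (Nat.cast_nonneg _) (h.pos _).le)]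
  exact ⟨by linarith [h.pos (n + 1)], by linarith [h.lt_one (n + 1)]⟩

theorem le_inv_digit (h : IsGaussOrbit a x) (n : ℕ) : x n ≤ 1 / a n := by
  have h1 := h.mul_eq n
  have h2 := h.pos n
  have h3 := h.pos (n + 1)
  rw [le_div_iff₀ (by linarith [h.one_le_digit n])]
  nlinarith [mul_pos h2 h3]

theorem inv_digit_add_one_le (h : IsGaussOrbit a x) (n : ℕ) : 1 / (a n + 1 : ℝ) ≤ x n := by
  have h1 := h.mul_eq n
  rw [div_le_iff₀ (by positivity)]
  nlinarith [h.pos n, h.lt_one (n + 1)]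

theorem abs_sub_eq (h : IsGaussOrbit a x) (h' : IsGaussOrbit a' x') (n : ℕ) :
    |x n - x' n| = x n * x' n * |(a n + x (n + 1)) - (a' n + x' (n + 1))| := by
  have e : x n - x' n = x n * x' n * -((a n + x (n + 1)) - (a' n + x' (n + 1))) := by
    linear_combination x' n * h.mul_eq n - x n * h'.mul_eq n
  rw [e, abs_mul, abs_neg, abs_of_pos (mul_pos (h.pos n) (h'.pos n))]

/-- Along a common prefix of length `n`, the distance is governed by the derivatives
`∏ x i ^ 2` of the inverse branches. -/
theorem abs_sub_eq_prod (h : IsGaussOrbit a x) (h' : IsGaussOrbit a' x') {n : ℕ}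
    (hn : ∀ i < n, a i = a' i) :
    |x 0 - x' 0| = (∏ i ∈ Finset.range n, x i) * (∏ i ∈ Finset.range n, x' i) *
      |x n - x' n| := by
  induction n with
  | zero => simp
  | succ n ih =>
    rw [ih fun i hi => hn i (by omega), h.abs_sub_eq h' n, hn n (by omega),
      Finset.prod_range_succ, Finset.prod_range_succ, add_sub_add_left_eq_sub]
    ring

theorem prod_pos (h : IsGaussOrbit a x) (n : ℕ) : 0 < ∏ i ∈ Finset.range n, x i :=
  Finset.prod_pos fun i _ => h.pos i

theorem prod_sq_le (h : IsGaussOrbit a x) (n : ℕ) :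
    (∏ i ∈ Finset.range n, x i) ^ 2 * 2 ^ n ≤ 2 := by
  have key : ∀ k, (∏ i ∈ Finset.range k, x i) * (∏ i ∈ Finset.range (k + 1), x i) * 2 ^ k ≤ 1 := by
    intro k
    induction k with
    | zero => simpa using (h.lt_one 0).le
    | succ k ih =>
      rw [Finset.prod_range_succ _ (k + 1)]
      nth_rewrite 1 [Finset.prod_range_succ]
      have h2 : x k * x (k + 1) * 2 ≤ 1 := by
        nlinarith [h.mul_eq k, h.pos k, h.lt_one (k + 1), h.pos (k + 1), h.one_le_digit k,
          mul_nonneg (h.pos k).le (sub_nonneg.2 (h.one_le_digit k)),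
          mul_pos (h.pos k) (sub_pos.2 (h.lt_one (k+1)))]
      have h3 : 0 ≤ (∏ i ∈ Finset.range k, x i) * (∏ i ∈ Finset.range (k + 1), x i) * 2 ^ k := by
        have := (h.prod_pos k).le; have := (h.prod_pos (k + 1)).le; positivity
      calc _ = ((∏ i ∈ Finset.range k, x i) * (∏ i ∈ Finset.range (k + 1), x i) * 2 ^ k) *
            (x k * x (k + 1) * 2) := by ring
        _ ≤ 1 * 1 := mul_le_mul ih h2 (by have := h.pos k; have := h.pos (k + 1); positivity)
            zero_le_one
        _ = 1 := one_mul 1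
  cases n with
  | zero => norm_num
  | succ n =>
    have h1 := key n
    have h2 := h.prod_pos n
    have h3 := h.prod_pos (n + 1)
    have h4 : ∏ i ∈ Finset.range (n + 1), x i ≤ ∏ i ∈ Finset.range n, x i := by
      rw [Finset.prod_range_succ]
      exact mul_le_of_le_one_right h2.le (h.lt_one n).le
    have h5 : (0 : ℝ) < 2 ^ n := by positivity
    have e : (∏ i ∈ Finset.range (n + 1), x i) ^ 2 * 2 ^ (n + 1) =
        (∏ i ∈ Finset.range (n + 1), x i) * ((∏ i ∈ Finset.range (n + 1), x i) * 2 ^ n) * 2 := by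
      ring
    rw [e]
    nlinarith [mul_le_mul_of_nonneg_right h4 (mul_pos h3 h5).le]

end IsGaussOrbit

/-- Every sequence of positive integers is the digit sequence of an infinite continued fraction.
By compactness of the cube it suffices to solve the first `n` equations. -/
theorem exists_isGaussOrbit {a : ℕ → ℕ} (ha : ∀ n, 1 ≤ a n) : ∃ x, IsGaussOrbit a x := by
  let K : ℕ → Set (ℕ → ℝ) := fun n =>
    Set.univ.pi (fun _ => Set.Icc (0 : ℝ) 1) ∩ {x | ∀ i < n, x i * (a i + x (i + 1)) = 1}
  have hcube : IsCompact (Set.univ.pi (fun _ : ℕ => Set.Icc (0 : ℝ) 1)) :=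
    isCompact_univ_pi fun _ => isCompact_Icc
  have hclosed : ∀ n : ℕ, IsClosed {x : ℕ → ℝ | ∀ i < n, x i * (a i + x (i + 1)) = 1} := by
    intro n
    simp only [Set.ofPred_forall]
    refine isClosed_iInter fun i => isClosed_iInter fun _ => isClosed_eq ?_ ?_ <;> fun_prop
  have hne : ∀ n, ∀ a : ℕ → ℕ, (∀ i, 1 ≤ a i) → ∃ x : ℕ → ℝ, (∀ i, x i ∈ Set.Icc (0 : ℝ) 1) ∧
      ∀ i < n, x i * (a i + x (i + 1)) = 1 := by
    intro n
    induction n with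
    | zero => exact fun a _ => ⟨0, fun i => by simp, by simp⟩
    | succ n ih =>
      intro a ha
      obtain ⟨x, hx, hx'⟩ := ih (fun i => a (i + 1)) fun i => ha _
      have h0 : (1 : ℝ) ≤ a 0 := by exact_mod_cast ha 0
      have h1 : (1 : ℝ) ≤ a 0 + x 0 := by linarith [(hx 0).1]
      refine ⟨fun i => Nat.casesOn i (1 / (a 0 + x 0)) x, ?_, ?_⟩
      · rintro (_ | i)
        · exact ⟨one_div_nonneg.2 (zero_le_one.trans h1), by simpa using inv_le_one_of_one_le₀ h1⟩
        · exact hx i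
      · rintro (_ | i) hi
        · exact one_div_mul_cancel (by positivity)
        · exact hx' i (by omega)
  obtain ⟨x, hx⟩ := IsCompact.nonempty_iInter_of_sequence_nonempty_isCompact_isClosed K
    (fun n x hx => ⟨hx.1, fun i hi => hx.2 i (by omega)⟩)
    (fun n => by
      obtain ⟨x, h1, h2⟩ := hne n a ha
      exact ⟨x, fun i _ => h1 i, h2⟩)
    (hcube.inter_right (hclosed 0)) fun n => hcube.isClosed.inter (hclosed n)
  rw [Set.mem_iInter] at hx
  have hI : ∀ n, x n ∈ Set.Icc (0 : ℝ) 1 := fun n => (hx 0).1 n (Set.mem_univ n)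
  have heq : ∀ n, x n * (a n + x (n + 1)) = 1 := fun n => (hx (n + 1)).2 n (by omega)
  have hpos : ∀ n, 0 < x n := fun n =>
    lt_of_le_of_ne (hI n).1 fun h0 => by simpa [← h0] using heq n
  refine ⟨x, ha, hpos, fun n => ?_, heq⟩
  have h1 : (1 : ℝ) ≤ a n := by exact_mod_cast ha n
  nlinarith [heq n, hpos n, hpos (n + 1), mul_pos (hpos n) (hpos (n + 1))]

theorem gaussMap_mem_Ico (x : ℝ) : gaussMap x ∈ Set.Ico (0 : ℝ) 1 :=
  ⟨Int.fract_nonneg _, Int.fract_lt_one _⟩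

theorem iterate_gaussMap_mem_Ico {x : ℝ} (hx : x ∈ Set.Ico (0 : ℝ) 1) (n : ℕ) :
    gaussMap^[n] x ∈ Set.Ico (0 : ℝ) 1 := by
  cases n with
  | zero => exact hx
  | succ n => rw [Function.iterate_succ_apply']; exact gaussMap_mem_Ico _

theorem isGaussOrbit_of_iterate_ne_zero {x : ℝ} (hx : x ∈ Set.Ico (0 : ℝ) 1)
    (h : ∀ n, gaussMap^[n] x ≠ 0) :
    IsGaussOrbit (fun n => partialQuotient (n + 1) x) (fun n => gaussMap^[n] x) := by
  have hI := iterate_gaussMap_mem_Ico hx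
  have hpos : ∀ n, 0 < gaussMap^[n] x := fun n => lt_of_le_of_ne (hI n).1 (h n).symm
  refine ⟨fun n => ?_, hpos, fun n => (hI n).2, fun n => ?_⟩
  · rw [partialQuotient, Nat.add_sub_cancel, Nat.one_le_floor_iff, le_div_iff₀ (hpos n), one_mul]
    exact (hI n).2.le
  · have e : ((partialQuotient (n + 1) x : ℕ) : ℝ) + gaussMap^[n + 1] x = 1 / gaussMap^[n] x := by
      rw [Function.iterate_succ_apply', partialQuotient, Nat.add_sub_cancel, gaussMap,
        natCast_floor_eq_intCast_floor (one_div_pos.2 (hpos n)).le, Int.floor_add_fract]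
    rw [e, mul_one_div_cancel (h n)]

theorem isGaussOrbit_of_irrational {x : ℝ} (hx : x ∈ Set.Ico (0 : ℝ) 1) (h : Irrational x) :
    IsGaussOrbit (fun n => partialQuotient (n + 1) x) (fun n => gaussMap^[n] x) := by
  refine isGaussOrbit_of_iterate_ne_zero hx fun n => ?_
  have : Irrational (gaussMap^[n] x) := by
    induction n with
    | zero => exact h
    | succ n ih =>
      rw [Function.iterate_succ_apply', gaussMap, Int.fract, one_div]
      exact ih.inv.sub_intCast _
  exact this.ne_zero

/-- The pair `(qₙ, qₙ₋₁)` of consecutive denominators of the convergents with digits `a`. -/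
def continuantPair (a : ℕ → ℕ) : ℕ → ℝ × ℝ
  | 0 => (1, 0)
  | n + 1 => (a n * (continuantPair a n).1 + (continuantPair a n).2, (continuantPair a n).1)

theorem continuantPair_nonneg (a : ℕ → ℕ) (n : ℕ) :
    0 ≤ (continuantPair a n).1 ∧ 0 ≤ (continuantPair a n).2 := by
  induction n with
  | zero => simp [continuantPair]
  | succ n ih =>
    obtain ⟨h1, h2⟩ := ih
    exact ⟨by simp only [continuantPair]; positivity, h1⟩

theorem continuantPair_snd_le {a : ℕ → ℕ} (ha : ∀ n, 1 ≤ a n) (n : ℕ) :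
    (continuantPair a n).2 ≤ (continuantPair a n).1 := by
  cases n with
  | zero => simp [continuantPair]
  | succ n =>
    have h1 : (1 : ℝ) ≤ a n := by exact_mod_cast ha n
    have := continuantPair_nonneg a n
    simp only [continuantPair]
    nlinarith

theorem continuantPair_add_le {a : ℕ → ℕ} (ha : ∀ n, 1 ≤ a n) (c : ℕ → ℕ) (n : ℕ) :
    (continuantPair (fun i => a i + c i) n).1 ≤
        (∏ i ∈ Finset.range n, (1 + c i : ℝ)) * (continuantPair a n).1 ∧
      (continuantPair (fun i => a i + c i) n).2 ≤
        (∏ i ∈ Finset.range n, (1 + c i : ℝ)) * (continuantPair a n).2 := by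
  induction n with
  | zero => simp [continuantPair]
  | succ n ih =>
    obtain ⟨h1, h2⟩ := ih
    have hP : 0 ≤ ∏ i ∈ Finset.range n, (1 + c i : ℝ) :=
      Finset.prod_nonneg fun i _ => by positivity
    obtain ⟨h3, h4⟩ := continuantPair_nonneg a n
    have h5 : (1 : ℝ) ≤ a n := by exact_mod_cast ha n
    have h6 : (0 : ℝ) ≤ c n := by positivity
    rw [Finset.prod_range_succ]
    set P := ∏ i ∈ Finset.range n, (1 + c i : ℝ)
    simp only [continuantPair]
    push_cast
    set p := continuantPair a n
    set q := continuantPair (fun i => a i + c i) n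
    constructor
    · have h7 : (a n + c n : ℝ) ≤ (1 + c n) * a n := by nlinarith
      calc (a n + c n : ℝ) * q.1 + q.2 ≤ ((1 + c n) * a n) * (P * p.1) + (1 + c n) * (P * p.2) := by
            have : q.2 ≤ (1 + c n) * (P * p.2) := by nlinarith [mul_nonneg h6 (mul_nonneg hP h4)]
            have h8 : (a n + c n : ℝ) * q.1 ≤ (a n + c n : ℝ) * (P * p.1) := by gcongr
            have h9 : (a n + c n : ℝ) * (P * p.1) ≤ ((1 + c n) * a n) * (P * p.1) := by gcongr
            linarith
        _ = _ := by ring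
    · nlinarith [mul_nonneg h6 (mul_nonneg hP h3)]

theorem IsGaussOrbit.prod_mul_continuant {a : ℕ → ℕ} {x : ℕ → ℝ} (h : IsGaussOrbit a x) (n : ℕ) :
    (∏ i ∈ Finset.range n, x i) *
      ((continuantPair a n).1 + (continuantPair a n).2 * x n) = 1 := by
  induction n with
  | zero => simp [continuantPair]
  | succ n ih =>
    rw [Finset.prod_range_succ, ← ih]
    simp only [continuantPair]
    linear_combination (∏ i ∈ Finset.range n, x i) * (continuantPair a n).1 * h.mul_eq n

/-- Adding `c i` to the `i`-th digit shrinks the derivatives of the inverse branches by a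
controlled factor. -/
theorem IsGaussOrbit.prod_le_prod_add {a c : ℕ → ℕ} {x y : ℕ → ℝ} (h : IsGaussOrbit a x)
    (h' : IsGaussOrbit (fun i => a i + c i) y) (n : ℕ) :
    ∏ i ∈ Finset.range n, x i ≤
      2 * (∏ i ∈ Finset.range n, (1 + c i : ℝ)) * ∏ i ∈ Finset.range n, y i := by
  have h1 := h.prod_mul_continuant n
  have h2 := h'.prod_mul_continuant n
  have h3 := (continuantPair_add_le h.digit_pos c n).1
  have h4 := continuantPair_snd_le h'.digit_pos n
  obtain ⟨h5, h6⟩ := continuantPair_nonneg a n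
  obtain ⟨h7, h8⟩ := continuantPair_nonneg (fun i => a i + c i) n
  have hX := h.prod_pos n
  have hY := h'.prod_pos n
  have hx := h.pos n
  have hy := h'.lt_one n
  set X := ∏ i ∈ Finset.range n, x i
  set Y := ∏ i ∈ Finset.range n, y i
  set P := ∏ i ∈ Finset.range n, (1 + c i : ℝ)
  set p := continuantPair a n
  set q := continuantPair (fun i => a i + c i) n
  have hXp : X * p.1 ≤ 1 := by nlinarith [mul_nonneg hX.le (mul_nonneg h6 hx.le)]
  have hYq : 1 ≤ Y * (2 * q.1) := by
    rw [← h2]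
    gcongr
    nlinarith [mul_le_mul_of_nonneg_left hy.le h8]
  have hP : 0 < P := Finset.prod_pos fun i _ => by positivity
  calc X = X * 1 := (mul_one X).symm
    _ ≤ X * (Y * (2 * q.1)) := by gcongr
    _ ≤ X * (Y * (2 * (P * p.1))) := by gcongr
    _ = 2 * P * Y * (X * p.1) := by ring
    _ ≤ 2 * P * Y * 1 := by gcongr
    _ = _ := mul_one _

theorem IsGaussOrbit.abs_sub_le_two_mul_inv_pow {a a' : ℕ → ℕ} {x x' : ℕ → ℝ}
    (h : IsGaussOrbit a x) (h' : IsGaussOrbit a' x') {n : ℕ} (hn : ∀ i < n, a i = a' i) :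
    |x 0 - x' 0| ≤ 2 * (1 / 2 ^ n) := by
  rw [h.abs_sub_eq_prod h' hn]
  have h1 := h.prod_sq_le n
  have h2 := h'.prod_sq_le n
  have h3 := h.prod_pos n
  have h4 := h'.prod_pos n
  have h5 : |x n - x' n| ≤ 1 := by
    rw [abs_le]
    constructor <;> linarith [h.pos n, h.lt_one n, h'.pos n, h'.lt_one n]
  set X := ∏ i ∈ Finset.range n, x i
  set Y := ∏ i ∈ Finset.range n, x' i
  calc X * Y * |x n - x' n| ≤ X * Y * 1 := by gcongr
    _ ≤ 2 * (1 / 2 ^ n) := by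
      rw [mul_one_div, le_div_iff₀ (by positivity)]
      have : (0 : ℝ) < 2 ^ n := by positivity
      nlinarith [mul_nonneg (sq_nonneg (X - Y)) this.le]

/-- Distinct infinite continued fractions have a first digit at which they differ. -/
theorem IsGaussOrbit.exists_digit_ne {a a' : ℕ → ℕ} {x x' : ℕ → ℝ}
    (h : IsGaussOrbit a x) (h' : IsGaussOrbit a' x') (hne : x 0 ≠ x' 0) :
    ∃ n, (∀ i < n, a i = a' i) ∧ a n ≠ a' n := by
  have hex : ∃ n, a n ≠ a' n := by
    by_contra! hall
    have hlim : Tendsto (fun n : ℕ => (2 : ℝ) * (1 / 2 ^ n)) atTop (nhds 0) := by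
      have := (tendsto_pow_atTop_nhds_zero_of_lt_one (r := (1 / 2 : ℝ)) (by norm_num)
        (by norm_num)).const_mul 2
      simpa [one_div] using this
    have := ge_of_tendsto' hlim fun n => h.abs_sub_le_two_mul_inv_pow h' (n := n) fun i _ => hall i
    exact hne (sub_eq_zero.1 (abs_nonpos_iff.1 this))
  classical
  exact ⟨Nat.find hex, fun i hi => not_not.1 (Nat.find_min hex hi), Nat.find_spec hex⟩

/-! ### Sets of full dimension with prescribed sparse large digits -/

/-- A map whose inverse is Hölder of exponent `s`, defined on a set of dimension `1`, forces its
target to have dimension at least `s`. -/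
theorem le_dimH_of_inverse_holder {A E : Set ℝ} (hA : 1 ≤ dimH A) {g : ℝ → ℝ}
    (hg : Set.MapsTo g A E) {C s : ℝ} (hs : 0 < s)
    (hC : ∀ u ∈ A, ∀ v ∈ A, |u - v| ≤ C * |g u - g v| ^ s) : ENNReal.ofReal s ≤ dimH E := by
  have hinj : Set.InjOn g A := fun u hu v hv huv => by
    have := hC u hu v hv
    rw [huv, sub_self, abs_zero, Real.zero_rpow hs.ne', mul_zero] at this
    exact sub_eq_zero.1 (abs_nonpos_iff.1 this)
  have hinv : Function.invFunOn g A '' (g '' A) = A := by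
    rw [Set.image_image]
    exact (Set.image_congr fun u hu => hinj.leftInvOn_invFunOn hu).trans (Set.image_id' A)
  have hhol : HolderOnWith C.toNNReal s.toNNReal (Function.invFunOn g A) (g '' A) := by
    rintro _ ⟨u, hu, rfl⟩ _ ⟨v, hv, rfl⟩
    rw [hinj.leftInvOn_invFunOn hu, hinj.leftInvOn_invFunOn hv, edist_dist, edist_dist,
      Real.coe_toNNReal s hs.le, ENNReal.ofReal_rpow_of_nonneg dist_nonneg hs.le,
      ← ENNReal.ofReal, ← ENNReal.ofReal_mul' (by positivity)]
    exact ENNReal.ofReal_le_ofReal (hC u hu v hv)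
  have h1 := hhol.dimH_image_le (Real.toNNReal_pos.2 hs)
  rw [hinv] at h1
  have h2 : dimH (g '' A) ≤ dimH E := dimH_mono (Set.image_subset_iff.2 hg)
  have h3 : (1 : ℝ≥0∞) ≤ dimH E / s.toNNReal := hA.trans (h1.trans (by gcongr))
  rwa [ENNReal.le_div_iff_mul_le (Or.inl (by simpa using hs)) (Or.inl ENNReal.coe_ne_top),
    one_mul] at h3

theorem one_le_dimH_irrational_Ico : 1 ≤ dimH {x : ℝ | x ∈ Set.Ico (0 : ℝ) 1 ∧ Irrational x} := by
  refine le_dimH_of_hausdorffMeasure_ne_zero (d := 1) ?_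
  have e : {x : ℝ | x ∈ Set.Ico (0 : ℝ) 1 ∧ Irrational x} =
      Set.Ico (0 : ℝ) 1 \ Set.range ((↑) : ℚ → ℝ) := rfl
  rw [NNReal.coe_one, MeasureTheory.hausdorffMeasure_real, e,
    MeasureTheory.measure_sdiff_null ((Set.countable_range _).measure_zero _), Real.volume_Ico]
  norm_num

namespace IsGaussOrbit

variable {a a' c : ℕ → ℕ} {x x' y y' : ℕ → ℝ}

theorem le_mul_of_add (h : IsGaussOrbit a x) (h' : IsGaussOrbit (fun i => a i + c i) y) (n : ℕ) :
    x n ≤ 2 * (1 + c n) * y n := by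
  have h1 := h.mul_eq n
  have h2 := h'.mul_eq n
  have h3 := h.one_le_digit n
  have h4 : (0 : ℝ) ≤ c n := by positivity
  push_cast at h2
  have h5 := h.pos n
  have h6 := h.pos (n + 1)
  have h7 := h'.pos n
  have h8 := h'.lt_one (n + 1)
  -- `a + c + y' ≤ 2 (1 + c) (a + x')`
  have h9 : (a n + c n + y (n + 1) : ℝ) ≤ 2 * (1 + c n) * (a n + x (n + 1)) := by nlinarith
  calc x n = x n * (y n * (a n + c n + y (n + 1))) := by rw [h2, mul_one]
    _ ≤ x n * (y n * (2 * (1 + c n) * (a n + x (n + 1)))) := by gcongr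
    _ = 2 * (1 + c n) * y n * (x n * (a n + x (n + 1))) := by ring
    _ = _ := by rw [h1, mul_one]

theorem one_sub_le_mul_of_add (h : IsGaussOrbit a x) (h' : IsGaussOrbit (fun i => a i + c i) y)
    (n : ℕ) : 1 - x n ≤ 4 * (1 + c (n + 1)) * (1 - y n) := by
  have h1 := h.mul_eq n
  have h2 := h'.mul_eq n
  have h4 : (0 : ℝ) ≤ c (n + 1) := by positivity
  have h5 := h.pos n
  have h7 := h'.pos n
  have h7' := h'.pos (n + 1)
  have h8 := h'.lt_one n
  have h8' := h'.lt_one (n + 1)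
  by_cases hd : a n + c n = 1
  · have ha : a n = 1 := by have := h.digit_pos n; omega
    have h9 := h.le_mul_of_add h' (n + 1)
    simp only [hd] at h2
    rw [ha] at h1
    push_cast at h1 h2
    -- both points are `1 / (1 + tail)`, so `1 - x = x * tail`
    have e1 : 1 - x n = x n * x (n + 1) := by linear_combination -h1
    have e2 : 1 - y n = y n * y (n + 1) := by linear_combination -h2
    have hy : 1 ≤ 2 * y n := by nlinarith
    rw [e1, e2]
    calc x n * x (n + 1) ≤ 1 * x (n + 1) := by
          gcongr
          exacts [(h.pos _).le, (h.lt_one n).le]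
      _ ≤ 2 * (1 + c (n + 1)) * y (n + 1) * 1 := by linarith
      _ ≤ 2 * (1 + c (n + 1)) * y (n + 1) * (2 * y n) := by gcongr
      _ = _ := by ring
  · have hd2 : (2 : ℝ) ≤ (a n + c n : ℕ) := by
      have : 2 ≤ a n + c n := by have := h'.digit_pos n; omega
      exact_mod_cast this
    have hy : y n ≤ 1 / 2 := by nlinarith [mul_pos h7 h7']
    nlinarith

theorem abs_sub_le_of_digit_lt (h : IsGaussOrbit a x) (h' : IsGaussOrbit a' x')
    (hy : IsGaussOrbit (fun i => a i + c i) y) (hy' : IsGaussOrbit (fun i => a' i + c i) y')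
    {n : ℕ} (hn : a n < a' n) :
    |x n - x' n| ≤
      16 * ((1 + c n) ^ 2 * (1 + c (n + 1)) * (1 + c (n + 2))) * |y n - y' n| := by
  rw [h.abs_sub_eq h', hy.abs_sub_eq hy']
  have hn' : (a n + 1 : ℝ) ≤ a' n := by exact_mod_cast hn
  have e1 := h.lt_one (n + 1)
  have e2 := h'.pos (n + 1)
  have e3 := hy.lt_one (n + 1)
  have e4 := hy'.pos (n + 1)
  have f1 := h.le_mul_of_add hy n
  have f2 := h'.le_mul_of_add hy' n
  have f3 := h'.le_mul_of_add hy' (n + 1)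
  have f4 := h.one_sub_le_mul_of_add hy (n + 1)
  have p1 := h.pos n
  have p2 := h'.pos n
  have p3 := hy.pos n
  have p4 := hy'.pos n
  have c0 : (0 : ℝ) ≤ c n := by positivity
  have c1 : (0 : ℝ) ≤ c (n + 1) := by positivity
  have c2 : (0 : ℝ) ≤ c (n + 1 + 1) := by positivity
  rw [abs_of_neg (by linarith), abs_of_neg (by push_cast; linarith), neg_sub, neg_sub]
  push_cast
  set u := 1 + (c n : ℝ)
  set v := 1 + (c (n + 1) : ℝ)
  set w := 1 + (c (n + 1 + 1) : ℝ)
  have hv : 1 ≤ v := by simp only [v]; linarith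
  have hw : 1 ≤ w := by simp only [w]; linarith
  have hu : 1 ≤ u := by simp only [u]; linarith
  have hvw : 1 ≤ v * w := one_le_mul_of_one_le_of_one_le hv hw
  -- the gap splits into the three nonnegative parts `a' - a - 1`, `x'`, `1 - x`
  have k1 : (a' n + x' (n + 1) - (a n + x (n + 1)) : ℝ) ≤
      4 * (v * w) * (a' n + c n + y' (n + 1) - (a n + c n + y (n + 1))) := by
    have g1 : (a' n - a n - 1 : ℝ) ≤ 4 * (v * w) * (a' n - a n - 1) :=
      le_mul_of_one_le_left (by linarith) (by linarith)
    have g2 : 2 * v * y' (n + 1) ≤ 4 * (v * w) * y' (n + 1) := by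
      gcongr ?_ * _
      nlinarith
    have g3 : 4 * w * (1 - y (n + 1)) ≤ 4 * (v * w) * (1 - y (n + 1)) := by
      gcongr ?_ * _
      nlinarith
    linarith
  calc x n * x' n * (a' n + x' (n + 1) - (a n + x (n + 1)))
      ≤ (2 * u * y n) * (2 * u * y' n) *
        (4 * (v * w) * (a' n + c n + y' (n + 1) - (a n + c n + y (n + 1)))) := by
        gcongr
        linarith
    _ = _ := by ring

/-- Adding the same `c i` to the digits of two continued fractions shrinks their distance by a
factor that is controlled by the first few `c i`, up to just beyond the first distinct digit. -/
theorem abs_sub_le_of_add (h : IsGaussOrbit a x) (h' : IsGaussOrbit a' x')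
    (hy : IsGaussOrbit (fun i => a i + c i) y) (hy' : IsGaussOrbit (fun i => a' i + c i) y')
    {n : ℕ} (hn : ∀ i < n, a i = a' i) (hne : a n ≠ a' n) :
    |x 0 - x' 0| ≤ 64 * (∏ i ∈ Finset.range (n + 3), (1 + c i : ℝ)) ^ 2 * |y 0 - y' 0| := by
  have hgap : |x n - x' n| ≤
      16 * ((1 + c n) ^ 2 * (1 + c (n + 1)) * (1 + c (n + 2))) * |y n - y' n| := by
    rcases lt_or_gt_of_ne hne with hlt | hlt
    · exact h.abs_sub_le_of_digit_lt h' hy hy' hlt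
    · rw [abs_sub_comm, abs_sub_comm (y n)]
      exact h'.abs_sub_le_of_digit_lt h hy' hy hlt
  rw [h.abs_sub_eq_prod h' hn, hy.abs_sub_eq_prod hy' fun i hi => by rw [hn i hi],
    Finset.prod_range_succ, Finset.prod_range_succ, Finset.prod_range_succ]
  have f1 := h.prod_le_prod_add hy n
  have f2 := h'.prod_le_prod_add hy' n
  have p1 := h.prod_pos n
  have p2 := h'.prod_pos n
  have p3 := hy.prod_pos n
  have p4 := hy'.prod_pos n
  have hP : 0 < ∏ i ∈ Finset.range n, (1 + c i : ℝ) := Finset.prod_pos fun i _ => by positivity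
  set P := ∏ i ∈ Finset.range n, (1 + c i : ℝ)
  set X := ∏ i ∈ Finset.range n, x i
  set X' := ∏ i ∈ Finset.range n, x' i
  set Y := ∏ i ∈ Finset.range n, y i
  set Y' := ∏ i ∈ Finset.range n, y' i
  have c1 : (1 : ℝ) ≤ 1 + c (n + 1) := by linarith [Nat.cast_nonneg (α := ℝ) (c (n + 1))]
  have c2 : (1 : ℝ) ≤ 1 + c (n + 2) := by linarith [Nat.cast_nonneg (α := ℝ) (c (n + 2))]
  calc X * X' * |x n - x' n| ≤ (2 * P * Y) * (2 * P * Y') *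
        (16 * ((1 + c n) ^ 2 * (1 + c (n + 1)) * (1 + c (n + 2))) * |y n - y' n|) := by gcongr
    _ = 64 * (P ^ 2 * (1 + c n) ^ 2 * (1 + c (n + 1)) * (1 + c (n + 2))) *
        (Y * Y' * |y n - y' n|) := by ring
    _ ≤ 64 * (P ^ 2 * (1 + c n) ^ 2 * (1 + c (n + 1)) ^ 2 * (1 + c (n + 2)) ^ 2) *
        (Y * Y' * |y n - y' n|) := by
      gcongr
      · exact le_self_pow₀ c1 two_ne_zero
      · exact le_self_pow₀ c2 two_ne_zero
    _ = _ := by ring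

end IsGaussOrbit

/-- If the products of the `1 + c i` grow at most like a small power of `2 ^ n`, then the
continued fractions whose digits exceed `c` have dimension close to `1`. -/
theorem le_dimH_digits_gt {c : ℕ → ℕ} {κ C : ℝ} (hκ : 0 < κ) (hC : 0 < C)
    (hc : ∀ n, (∏ i ∈ Finset.range n, (1 + c i : ℝ)) ^ 2 ≤ C * (2 ^ n) ^ κ) :
    ENNReal.ofReal (1 / (1 + κ)) ≤
      dimH {x : ℝ | x ∈ Set.Ico (0 : ℝ) 1 ∧ ∀ n, c n < partialQuotient (n + 1) x} := by
  have hex : ∀ u ∈ {x : ℝ | x ∈ Set.Ico (0 : ℝ) 1 ∧ Irrational x}, ∃ y,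
      IsGaussOrbit (fun n => partialQuotient (n + 1) u + c n) y := fun u hu =>
    exists_isGaussOrbit fun n =>
      le_add_right ((isGaussOrbit_of_irrational hu.1 hu.2).digit_pos n)
  choose! y hy using hex
  have hκ1 : 0 < 1 + κ := by linarith
  set M : ℝ := 64 * C * 8 ^ κ * 2 ^ κ with hM
  have hM0 : 0 < M := by positivity
  refine le_dimH_of_inverse_holder one_le_dimH_irrational_Ico (g := fun u => y u 0)
    (C := M ^ (1 / (1 + κ))) (fun u hu => ?_) (by positivity) fun u hu v hv => ?_
  · refine ⟨⟨((hy u hu).pos 0).le, (hy u hu).lt_one 0⟩, fun n => ?_⟩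
    rw [(hy u hu).partialQuotient_eq n]
    have := (isGaussOrbit_of_irrational hu.1 hu.2).digit_pos n
    omega
  rcases eq_or_ne u v with rfl | huv
  · simp only [sub_self, abs_zero]
    positivity
  have hu' := isGaussOrbit_of_irrational hu.1 hu.2
  have hv' := isGaussOrbit_of_irrational hv.1 hv.2
  obtain ⟨n, hn, hne⟩ := hu'.exists_digit_ne hv' huv
  have h1 := hu'.abs_sub_le_of_add hv' (hy u hu) (hy v hv) hn hne
  have h2 := hu'.abs_sub_le_two_mul_inv_pow hv' hn
  simp only [Function.iterate_zero, id_eq] at h1 h2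
  have h0 : 0 < |u - v| := abs_pos.2 (sub_ne_zero.2 huv)
  set Δ := |u - v|
  set δ := |y u 0 - y v 0|
  have hδ : 0 ≤ δ := abs_nonneg _
  have h3 : (2 ^ n : ℝ) ≤ 2 / Δ := by
    rw [le_div_iff₀ h0]
    rwa [mul_one_div, le_div_iff₀ (by positivity), mul_comm] at h2
  have h4 : Δ * Δ ^ κ ≤ M * δ := by
    calc Δ * Δ ^ κ ≤ (64 * (C * (2 ^ (n + 3)) ^ κ) * δ) * Δ ^ κ := by
          gcongr
          exact h1.trans (by gcongr; exact hc (n + 3))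
      _ = 64 * C * 8 ^ κ * (2 ^ n) ^ κ * Δ ^ κ * δ := by
          rw [pow_add, Real.mul_rpow (by positivity) (by positivity)]
          norm_num
          ring
      _ ≤ 64 * C * 8 ^ κ * (2 / Δ) ^ κ * Δ ^ κ * δ := by gcongr
      _ = M * δ := by
          rw [Real.div_rpow (by norm_num) h0.le, hM]
          have : Δ ^ κ ≠ 0 := (Real.rpow_pos_of_pos h0 κ).ne'
          field_simp
  rw [← Real.mul_rpow hM0.le hδ, one_div, Real.le_rpow_inv_iff_of_pos h0.le (by positivity) hκ1,
    Real.rpow_add h0, Real.rpow_one]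
  exact h4

/-- If `Φ` is at most `exp (ε n)` infinitely often for every `ε > 0`, then it can be exceeded
infinitely often by the digits of a set of full dimension. The positions at which a large digit is
prescribed are chosen with the rates `ε / 2 ^ (j + 1)`, so that the product of all prescribed digits
up to `n` is at most `exp (ε n)`. -/
theorem one_le_dimH_frequently_le_digit {Φ : ℕ → ℝ}
    (h : ∀ ε > 0, ∃ᶠ n : ℕ in atTop, Φ n ≤ Real.exp (ε * n)) :
    1 ≤ dimH {x : ℝ | x ∈ Set.Ico (0 : ℝ) 1 ∧ (∀ n, 1 ≤ partialQuotient (n + 1) x) ∧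
      ∃ᶠ n in atTop, Φ n ≤ partialQuotient (n + 1) x} := by
  have key : ∀ κ : ℝ, 0 < κ → ENNReal.ofReal (1 / (1 + κ)) ≤ dimH {x : ℝ | x ∈ Set.Ico (0 : ℝ) 1 ∧
      (∀ n, 1 ≤ partialQuotient (n + 1) x) ∧ ∃ᶠ n in atTop, Φ n ≤ partialQuotient (n + 1) x} := by
    intro κ hκ
    set ε : ℝ := κ * Real.log 2 / 2 with hε
    have hlog : 0 < Real.log 2 := Real.log_pos one_lt_two
    have hε0 : 0 < ε := by positivity
    have hfreq : ∀ j : ℕ, ∃ᶠ k : ℕ in atTop, (1 + ⌈Φ k⌉₊ : ℝ) ≤ Real.exp (ε / 2 / 2 ^ j * k) := by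
      intro j
      have hη : 0 < ε / 2 / 2 ^ j / 2 := by positivity
      have hev : ∀ᶠ k : ℕ in atTop, 2 ≤ ε / 2 / 2 ^ j / 2 * (k : ℝ) :=
        (tendsto_natCast_atTop_atTop.const_mul_atTop hη).eventually_ge_atTop 2
      refine ((h _ hη).and_eventually hev).mono fun k ⟨hk1, hk2⟩ => ?_
      have e : Real.exp (ε / 2 / 2 ^ j * k) = Real.exp (ε / 2 / 2 ^ j / 2 * k) ^ 2 := by
        rw [← Real.exp_nat_mul]
        congr 1
        push_cast
        ring
      have h3 : (⌈Φ k⌉₊ : ℝ) ≤ Real.exp (ε / 2 / 2 ^ j / 2 * k) + 1 := by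
        calc (⌈Φ k⌉₊ : ℝ) ≤ (⌈Real.exp (ε / 2 / 2 ^ j / 2 * k)⌉₊ : ℝ) := by
              exact_mod_cast Nat.ceil_mono hk1
          _ ≤ _ := (Nat.ceil_lt_add_one (Real.exp_pos _).le).le
      have h4 := Real.add_one_le_exp (ε / 2 / 2 ^ j / 2 * k)
      rw [e]
      nlinarith
    obtain ⟨φ, hφ, hφΦ⟩ := extraction_forall_of_frequently hfreq
    classical
    set c : ℕ → ℕ := fun i => if i ∈ Set.range φ then ⌈Φ i⌉₊ else 0 with hc
    have hprod : ∀ n, ∏ i ∈ Finset.range n, (1 + c i : ℝ) ≤ Real.exp (ε * n) := by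
      intro n
      set S := (Finset.range n).filter fun j => φ j < n
      have hsub : S.image φ ⊆ Finset.range n := by
        intro i hi
        obtain ⟨j, hj, rfl⟩ := Finset.mem_image.1 hi
        exact Finset.mem_range.2 (Finset.mem_filter.1 hj).2
      rw [← Finset.prod_subset hsub, Finset.prod_image hφ.injective.injOn]
      · calc ∏ j ∈ S, (1 + c (φ j) : ℝ) ≤ ∏ j ∈ S, Real.exp (ε / 2 / 2 ^ j * n) := by
              refine Finset.prod_le_prod (fun j _ => by positivity) fun j hj => ?_
              have h1 : (1 + c (φ j) : ℝ) = 1 + ⌈Φ (φ j)⌉₊ := by simp [hc]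
              rw [h1]
              refine (hφΦ j).trans (Real.exp_le_exp.2 ?_)
              have : ((φ j : ℕ) : ℝ) ≤ n := by exact_mod_cast (Finset.mem_filter.1 hj).2.le
              gcongr
          _ = Real.exp ((∑ j ∈ S, ε / 2 / 2 ^ j) * n) := by rw [← Real.exp_sum, Finset.sum_mul]
          _ ≤ Real.exp (ε * n) := by
              gcongr
              exact sum_le_hasSum S (fun j _ => by positivity) (hasSum_geometric_two' ε)
      · intro i hi hiS
        have : i ∉ Set.range φ := by
          rintro ⟨j, rfl⟩
          have hlt := Finset.mem_range.1 hi
          exact hiS (Finset.mem_image_of_mem φ (Finset.mem_filter.2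
            ⟨Finset.mem_range.2 ((hφ.id_le j).trans_lt hlt), hlt⟩))
        simp only [hc, if_neg this, Nat.cast_zero, add_zero]
    refine (le_dimH_digits_gt (c := c) hκ one_pos fun n => ?_).trans (dimH_mono ?_)
    · calc (∏ i ∈ Finset.range n, (1 + c i : ℝ)) ^ 2 ≤ Real.exp (ε * n) ^ 2 := by
            have : 0 ≤ ∏ i ∈ Finset.range n, (1 + c i : ℝ) :=
              Finset.prod_nonneg fun i _ => by positivity
            gcongr
            exact hprod n
        _ = 1 * (2 ^ n) ^ κ := by
            rw [one_mul, ← Real.exp_nat_mul, Real.rpow_def_of_pos (by positivity), Real.log_pow, hε]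
            congr 1
            push_cast
            ring
    · rintro x ⟨hx, hx'⟩
      refine ⟨hx, fun n => (Nat.zero_le _).trans_lt (hx' n),
        hφ.tendsto_atTop.frequently (Frequently.of_forall fun j => ?_)⟩
      have h1 := hx' (φ j)
      simp only [hc, Set.mem_range_self, if_true] at h1
      exact (Nat.le_ceil _).trans (by exact_mod_cast h1.le)
  have hlim : Tendsto (fun κ : ℝ => ENNReal.ofReal (1 / (1 + κ))) (nhdsWithin 0 (Set.Ioi 0))
      (nhds 1) := by
    have hcont : ContinuousAt (fun κ : ℝ => ENNReal.ofReal (1 / (1 + κ))) 0 :=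
      ENNReal.continuous_ofReal.continuousAt.comp
        (continuousAt_const.div (by fun_prop) (by norm_num))
    have := hcont.tendsto
    simp only [add_zero, div_one, ENNReal.ofReal_one] at this
    exact this.mono_left nhdsWithin_le_nhds
  exact le_of_tendsto hlim (eventually_nhdsWithin_of_forall fun κ hκ => key κ hκ)

/-! ### Digits of doubly exponential growth, by mixed radix expansions -/

/-- The remainders of the mixed radix expansion of `u ∈ [0, 1)` with bases `N 0, N 1, …`. -/
noncomputable def mixedRadixTail (N : ℕ → ℕ) (u : ℝ) : ℕ → ℝ
  | 0 => u
  | n + 1 => Int.fract (N n * mixedRadixTail N u n)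

/-- The digits, `0 ≤ d n < N n`, of the mixed radix expansion of `u ∈ [0, 1)`. -/
noncomputable def mixedRadixDigit (N : ℕ → ℕ) (u : ℝ) (n : ℕ) : ℕ := ⌊N n * mixedRadixTail N u n⌋₊

section MixedRadix

variable {N : ℕ → ℕ} {u v : ℝ}

theorem mixedRadixTail_mem_Ico (hu : u ∈ Set.Ico (0 : ℝ) 1) (n : ℕ) :
    mixedRadixTail N u n ∈ Set.Ico (0 : ℝ) 1 := by
  cases n with
  | zero => exact hu
  | succ n => exact ⟨Int.fract_nonneg _, Int.fract_lt_one _⟩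

theorem mul_mixedRadixTail (hu : u ∈ Set.Ico (0 : ℝ) 1) (n : ℕ) :
    N n * mixedRadixTail N u n = mixedRadixDigit N u n + mixedRadixTail N u (n + 1) := by
  rw [mixedRadixTail, mixedRadixDigit, natCast_floor_eq_intCast_floor
    (mul_nonneg (Nat.cast_nonneg _) (mixedRadixTail_mem_Ico hu n).1), Int.floor_add_fract]

theorem mixedRadixDigit_lt (hN : ∀ n, 2 ≤ N n) (hu : u ∈ Set.Ico (0 : ℝ) 1) (n : ℕ) :
    mixedRadixDigit N u n < N n := by
  obtain ⟨h1, h2⟩ := mixedRadixTail_mem_Ico (N := N) hu n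
  have h3 : (0 : ℝ) < N n := by exact_mod_cast (by have := hN n; omega : 0 < N n)
  rw [mixedRadixDigit, Nat.floor_lt (by positivity)]
  nlinarith

theorem abs_sub_mul_prod_mixedRadix (hu : u ∈ Set.Ico (0 : ℝ) 1) (hv : v ∈ Set.Ico (0 : ℝ) 1) {n : ℕ}
    (hn : ∀ i < n, mixedRadixDigit N u i = mixedRadixDigit N v i) :
    |u - v| * ∏ i ∈ Finset.range n, (N i : ℝ) =
      |mixedRadixTail N u n - mixedRadixTail N v n| := by
  induction n with
  | zero => simp [mixedRadixTail]
  | succ n ih =>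
    rw [Finset.prod_range_succ, ← mul_assoc, ih fun i hi => hn i (by omega),
      ← abs_of_nonneg (Nat.cast_nonneg (α := ℝ) (N n)), ← abs_mul]
    congr 1
    have h1 := mul_mixedRadixTail (N := N) hu n
    have h2 := mul_mixedRadixTail (N := N) hv n
    rw [hn n (by omega)] at h1
    linear_combination h1 - h2

theorem abs_mixedRadixTail_sub_le (hu : u ∈ Set.Ico (0 : ℝ) 1) (hv : v ∈ Set.Ico (0 : ℝ) 1)
    (n : ℕ) : |mixedRadixTail N u n - mixedRadixTail N v n| ≤ 1 := by
  obtain ⟨h1, h2⟩ := mixedRadixTail_mem_Ico (N := N) hu n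
  obtain ⟨h3, h4⟩ := mixedRadixTail_mem_Ico (N := N) hv n
  rw [abs_le]
  constructor <;> linarith

theorem exists_mixedRadixDigit_ne (hN : ∀ n, 2 ≤ N n) (hu : u ∈ Set.Ico (0 : ℝ) 1)
    (hv : v ∈ Set.Ico (0 : ℝ) 1) (hne : u ≠ v) :
    ∃ n, (∀ i < n, mixedRadixDigit N u i = mixedRadixDigit N v i) ∧
      mixedRadixDigit N u n ≠ mixedRadixDigit N v n := by
  have hex : ∃ n, mixedRadixDigit N u n ≠ mixedRadixDigit N v n := by
    by_contra! hall
    have hle : ∀ n : ℕ, |u - v| ≤ (1 / 2 : ℝ) ^ n := by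
      intro n
      have h1 := (abs_sub_mul_prod_mixedRadix hu hv (N := N) (n := n) fun i _ => hall i).trans_le
        (abs_mixedRadixTail_sub_le hu hv n)
      have h2 : (2 : ℝ) ^ n ≤ ∏ i ∈ Finset.range n, (N i : ℝ) := by
        simpa using Finset.prod_le_prod (s := Finset.range n) (f := fun _ => (2 : ℝ))
          (g := fun i => (N i : ℝ)) (fun _ _ => by norm_num) fun i _ => by exact_mod_cast hN i
      rw [one_div, inv_pow, ← one_div, le_div_iff₀ (by positivity)]
      exact (mul_le_mul_of_nonneg_left h2 (abs_nonneg _)).trans h1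
    have := ge_of_tendsto' (tendsto_pow_atTop_nhds_zero_of_lt_one (r := (1 / 2 : ℝ))
      (by norm_num) (by norm_num)) hle
    exact hne (sub_eq_zero.1 (abs_nonpos_iff.1 this))
  classical
  exact ⟨Nat.find hex, fun i hi => not_not.1 (Nat.find_min hex hi), Nat.find_spec hex⟩

/-- At the first distinct digit the distance is at most the difference of the digits, up to the
scale of the cylinder. -/
theorem abs_mixedRadixTail_sub_mul_le (hu : u ∈ Set.Ico (0 : ℝ) 1) (hv : v ∈ Set.Ico (0 : ℝ) 1)
    {n : ℕ} (hne : mixedRadixDigit N u n ≠ mixedRadixDigit N v n) :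
    |mixedRadixTail N u n - mixedRadixTail N v n| * N n ≤
      2 * |(mixedRadixDigit N u n : ℝ) - mixedRadixDigit N v n| := by
  have h1 := mul_mixedRadixTail (N := N) hu n
  have h2 := mul_mixedRadixTail (N := N) hv n
  have h3 := abs_mixedRadixTail_sub_le (N := N) hu hv (n + 1)
  have h4 : (1 : ℝ) ≤ |(mixedRadixDigit N u n : ℝ) - mixedRadixDigit N v n| := by
    have : (1 : ℤ) ≤ |(mixedRadixDigit N u n : ℤ) - mixedRadixDigit N v n| :=
      Int.one_le_abs (sub_ne_zero.2 (by exact_mod_cast hne))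
    exact_mod_cast this
  rw [← abs_of_nonneg (Nat.cast_nonneg (α := ℝ) (N n)), ← abs_mul]
  have e : (mixedRadixTail N u n - mixedRadixTail N v n) * N n =
      (mixedRadixDigit N u n - mixedRadixDigit N v n : ℝ) +
      (mixedRadixTail N u (n + 1) - mixedRadixTail N v (n + 1)) := by
    linear_combination h1 - h2
  rw [e]
  exact (abs_add_le _ _).trans (by linarith)

end MixedRadix

/-- Lower bound for the distance of two continued fractions with digits in `[N i, 2 N i)`, in terms
of the difference of the first digits that are distinct. -/
theorem IsGaussOrbit.abs_digit_sub_le {N a a' : ℕ → ℕ} {x x' : ℕ → ℝ} (h : IsGaussOrbit a x)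
    (h' : IsGaussOrbit a' x') (hN : ∀ n, 2 ≤ N n) (ha : ∀ n, N n ≤ a n ∧ a n < 2 * N n)
    (ha' : ∀ n, N n ≤ a' n ∧ a' n < 2 * N n) {n : ℕ} (hn : ∀ i < n, a i = a' i)
    (hne : a n ≠ a' n) :
    |(a n : ℝ) - a' n| ≤
      8 * 4 ^ n * (∏ i ∈ Finset.range n, (N i : ℝ)) ^ 2 * (N n) ^ 2 * |x 0 - x' 0| := by
  have hNpos : ∀ i, (0 : ℝ) < N i := fun i => by
    exact_mod_cast (by have := hN i; omega : 0 < N i)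
  have low : ∀ {b : ℕ → ℕ} {z : ℕ → ℝ}, IsGaussOrbit b z → (∀ n, N n ≤ b n ∧ b n < 2 * N n) →
      ∀ i, 1 ≤ 2 * N i * z i := by
    intro b z hz hb i
    have h1 := hz.inv_digit_add_one_le i
    have h2 : (b i + 1 : ℝ) ≤ 2 * N i := by exact_mod_cast (hb i).2
    rw [div_le_iff₀ (by positivity)] at h1
    nlinarith [hz.pos i]
  have half : ∀ {b : ℕ → ℕ} {z : ℕ → ℝ}, IsGaussOrbit b z → (∀ n, N n ≤ b n ∧ b n < 2 * N n) →
      ∀ i, z i ≤ 1 / 2 := by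
    intro b z hz hb i
    refine (hz.le_inv_digit i).trans (one_div_le_one_div_of_le two_pos ?_)
    exact_mod_cast (hN i).trans (hb i).1
  have lowprod : ∀ {b : ℕ → ℕ} {z : ℕ → ℝ}, IsGaussOrbit b z →
      (∀ n, N n ≤ b n ∧ b n < 2 * N n) →
      1 ≤ 2 ^ n * (∏ i ∈ Finset.range n, (N i : ℝ)) * ∏ i ∈ Finset.range n, z i := by
    intro b z hz hb
    have e : 2 ^ n * (∏ i ∈ Finset.range n, (N i : ℝ)) * ∏ i ∈ Finset.range n, z i =
        ∏ i ∈ Finset.range n, (2 * N i * z i) := by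
      simp [Finset.prod_mul_distrib]
    rw [e]
    simpa using Finset.prod_le_prod (s := Finset.range n) (f := fun _ => (1 : ℝ))
      (g := fun i => 2 * N i * z i) (fun _ _ => by norm_num) fun i _ => low hz hb i
  have hD : (1 : ℝ) ≤ |(a n : ℝ) - a' n| := by
    have : (1 : ℤ) ≤ |(a n : ℤ) - a' n| := Int.one_le_abs (sub_ne_zero.2 (by exact_mod_cast hne))
    exact_mod_cast this
  have hgap : |(a n : ℝ) - a' n| ≤ 2 * |(a n + x (n + 1)) - (a' n + x' (n + 1))| := by
    have h1 : |x' (n + 1) - x (n + 1)| ≤ 1 / 2 := by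
      rw [abs_le]
      constructor <;> linarith [h.pos (n + 1), h'.pos (n + 1), half h ha (n + 1),
        half h' ha' (n + 1)]
    have h2 := abs_add_le ((a n + x (n + 1)) - (a' n + x' (n + 1))) (x' (n + 1) - x (n + 1))
    rw [show (a n + x (n + 1)) - (a' n + x' (n + 1)) + (x' (n + 1) - x (n + 1)) =
      (a n : ℝ) - a' n by ring] at h2
    linarith
  rw [h.abs_sub_eq_prod h' hn, h.abs_sub_eq h' n]
  have l1 := lowprod h ha
  have l2 := lowprod h' ha'
  have l3 := low h ha n
  have l4 := low h' ha' n
  set P := ∏ i ∈ Finset.range n, (N i : ℝ)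
  set X := ∏ i ∈ Finset.range n, x i
  set X' := ∏ i ∈ Finset.range n, x' i
  set G := |(a n + x (n + 1)) - (a' n + x' (n + 1))|
  have l5 : 1 ≤ (2 ^ n * P * X) * (2 ^ n * P * X') * ((2 * N n * x n) * (2 * N n * x' n)) :=
    one_le_mul_of_one_le_of_one_le (one_le_mul_of_one_le_of_one_le l1 l2)
      (one_le_mul_of_one_le_of_one_le l3 l4)
  calc |(a n : ℝ) - a' n| ≤ 1 * (2 * G) := by rwa [one_mul]
    _ ≤ (2 ^ n * P * X) * (2 ^ n * P * X') * ((2 * N n * x n) * (2 * N n * x' n)) * (2 * G) := by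
      gcongr
    _ = _ := by
      have : (4 : ℝ) ^ n = 2 ^ n * 2 ^ n := by rw [← mul_pow]; norm_num
      rw [this]
      ring

theorem exists_mul_le_pow_add {c : ℝ} (hc : 1 < c) (M : ℝ) : ∃ K : ℝ, ∀ n : ℕ, M * n ≤ c ^ n + K := by
  have h := (tendsto_pow_const_div_const_pow_of_one_lt 1 hc).const_mul M
  rw [mul_zero] at h
  obtain ⟨n₀, hn₀⟩ := eventually_atTop.1 (h.eventually_le_const one_pos)
  refine ⟨|M| * n₀, fun n => ?_⟩
  have hpos : (0 : ℝ) < c ^ n := by positivity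
  rcases le_total n₀ n with hle | hle
  · have := hn₀ n hle
    rw [pow_one, ← mul_div_assoc, div_le_one hpos] at this
    have : 0 ≤ |M| * (n₀ : ℝ) := by positivity
    linarith
  · have h1 : M * n ≤ |M| * n := by gcongr; exact le_abs_self M
    have h2 : |M| * n ≤ |M| * n₀ := by gcongr
    linarith

/-- Growth estimate behind the exponent `1 / (1 + c)`: if `N n` is about `exp (c ^ (n + 1))`, then
`N n` is about `(N 0 ⋯ N (n - 1)) ^ (c - 1)`. -/
theorem exists_rpow_le_mul_prod {N : ℕ → ℕ} {c s : ℝ} (hc : 1 < c) (hs : 0 < s)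
    (hsc : s * (1 + c) < 1) (h1 : ∀ n, Real.exp (c ^ (n + 1)) ≤ N n)
    (h2 : ∀ n, (N n : ℝ) ≤ 2 * Real.exp (c ^ (n + 1))) :
    ∃ K : ℝ, 0 < K ∧ ∀ n, (16 * 4 ^ n * (∏ i ∈ Finset.range n, (N i : ℝ)) ^ 2 * N n) ^ s ≤
      K * ∏ i ∈ Finset.range n, (N i : ℝ) := by
  have hθ : 0 < (1 - s * (1 + c)) / (c - 1) := div_pos (by linarith) (by linarith)
  set θ := (1 - s * (1 + c)) / (c - 1) with hθdef
  obtain ⟨K, hK⟩ := exists_mul_le_pow_add hc (s * Real.log 4 / θ)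
  refine ⟨Real.exp (s * (Real.log 32 + c) + θ * (c + K)), Real.exp_pos _, fun n => ?_⟩
  have hNpos : ∀ i, (0 : ℝ) < N i := fun i => (Real.exp_pos _).trans_le (h1 i)
  have hP : 0 < ∏ i ∈ Finset.range n, (N i : ℝ) := Finset.prod_pos fun i _ => hNpos i
  have hlogP : (c ^ (n + 1) - c) / (c - 1) ≤ Real.log (∏ i ∈ Finset.range n, (N i : ℝ)) := by
    rw [Real.log_prod fun i _ => (hNpos i).ne']
    have e : (c ^ (n + 1) - c) / (c - 1) = ∑ i ∈ Finset.range n, c ^ (i + 1) := by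
      rw [div_eq_iff (by linarith)]
      have := geom_sum_mul c n
      simp_rw [pow_succ]
      rw [← Finset.sum_mul]
      linear_combination -c * this
    rw [e]
    exact Finset.sum_le_sum fun i _ => (Real.le_log_iff_exp_le (hNpos i)).2 (h1 i)
  set P := ∏ i ∈ Finset.range n, (N i : ℝ)
  set p := Real.log P with hp
  have hPexp : P = Real.exp p := (Real.exp_log hP).symm
  have hlogN : Real.log (N n) ≤ Real.log 2 + c ^ (n + 1) := by
    rw [← Real.log_exp (c ^ (n + 1)), ← Real.log_mul two_ne_zero (Real.exp_pos _).ne']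
    exact Real.log_le_log (hNpos n) (h2 n)
  rw [Real.rpow_def_of_pos (by have := hNpos n; positivity)]
  conv_rhs => rw [hPexp, ← Real.exp_add]
  refine Real.exp_le_exp.2 ?_
  have elog : Real.log (16 * 4 ^ n * P ^ 2 * N n) =
      Real.log 16 + n * Real.log 4 + 2 * p + Real.log (N n) := by
    rw [Real.log_mul (by positivity) (hNpos n).ne', Real.log_mul (by positivity) (by positivity),
      Real.log_mul (by norm_num) (by positivity), Real.log_pow, Real.log_pow]
    norm_num [hp]
  have e32 : Real.log 32 = Real.log 16 + Real.log 2 := by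
    rw [← Real.log_mul (by norm_num) (by norm_num)]
    norm_num
  rw [elog]
  have hc1 : 0 < c - 1 := by linarith
  have h3 : c ^ (n + 1) ≤ (c - 1) * p + c := by
    rw [div_le_iff₀ hc1] at hlogP
    linarith
  have h4 : s * Real.log 4 * n ≤ θ * (c ^ n + K) := by
    have := mul_le_mul_of_nonneg_left (hK n) hθ.le
    calc s * Real.log 4 * n = θ * (s * Real.log 4 / θ * n) := by field_simp
      _ ≤ _ := this
  have h5 : θ * (c ^ n - c) ≤ (1 - s * (1 + c)) * p := by
    have h6 : c ^ n ≤ c ^ (n + 1) := pow_le_pow_right₀ hc.le (by omega)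
    have h7 : θ * (c ^ (n + 1) - c) = (1 - s * (1 + c)) * ((c ^ (n + 1) - c) / (c - 1)) := by
      rw [hθdef]
      ring
    calc θ * (c ^ n - c) ≤ θ * (c ^ (n + 1) - c) := by gcongr
      _ = (1 - s * (1 + c)) * ((c ^ (n + 1) - c) / (c - 1)) := h7
      _ ≤ _ := by gcongr
  have h8 := mul_le_mul_of_nonneg_left h3 hs.le
  have h9 := mul_le_mul_of_nonneg_left hlogN hs.le
  nlinarith

/-- The points all of whose digits satisfy `a n ≥ exp (c ^ n)` have dimension at least
`1 / (1 + c)`. The digits in `[N n, 2 N n)`, with `N n` about `exp (c ^ n)`, are parametrized by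
the mixed radix expansion of a point of `[0, 1)`. -/
theorem le_dimH_exp_pow_le_digit {c s : ℝ} (hc : 1 < c) (hs : 0 < s) (hsc : s * (1 + c) < 1) :
    ENNReal.ofReal s ≤ dimH {x : ℝ | x ∈ Set.Ico (0 : ℝ) 1 ∧
      ∀ n, Real.exp (c ^ (n + 1)) ≤ partialQuotient (n + 1) x} := by
  set N : ℕ → ℕ := fun n => ⌈Real.exp (c ^ (n + 1))⌉₊ with hNdef
  have h1 : ∀ n, Real.exp (c ^ (n + 1)) ≤ N n := fun n => Nat.le_ceil _
  have hexp : ∀ n, 2 ≤ Real.exp (c ^ (n + 1)) := fun n => by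
    have := Real.add_one_le_exp (c ^ (n + 1))
    have := one_le_pow₀ hc.le (n := n + 1)
    linarith
  have h2 : ∀ n, (N n : ℝ) ≤ 2 * Real.exp (c ^ (n + 1)) := fun n => by
    have := Nat.ceil_lt_add_one (Real.exp_pos (c ^ (n + 1))).le
    have := hexp n
    linarith
  have hN : ∀ n, 2 ≤ N n := fun n => by exact_mod_cast (hexp n).trans (h1 n)
  obtain ⟨K, hK0, hK⟩ := exists_rpow_le_mul_prod hc hs hsc h1 h2
  have hex : ∀ u : ℝ, ∃ y, IsGaussOrbit (fun n => N n + mixedRadixDigit N u n) y := fun u =>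
    exists_isGaussOrbit fun n => le_add_right (one_le_two.trans (hN n))
  choose y hy using hex
  have hs1 : s ≤ 1 := by nlinarith
  have hdim : 1 ≤ dimH (Set.Ico (0 : ℝ) 1) :=
    one_le_dimH_irrational_Ico.trans (dimH_mono fun x hx => hx.1)
  refine le_dimH_of_inverse_holder hdim (g := fun u => y u 0) (C := K) (fun u hu => ?_) hs
    fun u hu v hv => ?_
  · refine ⟨⟨((hy u).pos 0).le, (hy u).lt_one 0⟩, fun n => ?_⟩
    rw [(hy u).partialQuotient_eq n]
    push_cast
    linarith [h1 n, Nat.cast_nonneg (α := ℝ) (mixedRadixDigit N u n)]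
  rcases eq_or_ne u v with rfl | huv
  · simp only [sub_self, abs_zero]
    positivity
  obtain ⟨n, hn, hne⟩ := exists_mixedRadixDigit_ne hN hu hv huv
  have hdig : ∀ w ∈ Set.Ico (0 : ℝ) 1, ∀ n, N n ≤ N n + mixedRadixDigit N w n ∧
      N n + mixedRadixDigit N w n < 2 * N n := fun w hw n => by
    have := mixedRadixDigit_lt hN hw n
    omega
  have g1 := (hy u).abs_digit_sub_le (hy v) hN (hdig u hu) (hdig v hv)
    (fun i hi => by rw [hn i hi]) (by omega : N n + mixedRadixDigit N u n ≠ _)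
  have g2 := abs_sub_mul_prod_mixedRadix hu hv hn
  have g3 := abs_mixedRadixTail_sub_le (N := N) hu hv n
  have g4 := abs_mixedRadixTail_sub_mul_le (N := N) hu hv hne
  have g5 := hK n
  have hNpos : ∀ i, (0 : ℝ) < N i := fun i => (Real.exp_pos _).trans_le (h1 i)
  have hP : 0 < ∏ i ∈ Finset.range n, (N i : ℝ) := Finset.prod_pos fun i _ => hNpos i
  push_cast at g1
  rw [add_sub_add_left_eq_sub] at g1
  set P := ∏ i ∈ Finset.range n, (N i : ℝ)
  set δ := |y u 0 - y v 0|
  set D := |(mixedRadixDigit N u n : ℝ) - mixedRadixDigit N v n|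
  set r := |mixedRadixTail N u n - mixedRadixTail N v n|
  have hδ : 0 ≤ δ := abs_nonneg _
  have hr : 0 ≤ r := abs_nonneg _
  have hNn := hNpos n
  have g6 : r ≤ 16 * 4 ^ n * P ^ 2 * N n * δ := by
    have : r * N n ≤ (16 * 4 ^ n * P ^ 2 * N n * δ) * N n := by linarith
    exact le_of_mul_le_mul_right this hNn
  -- as `r ≤ 1`, passing to the power `s ≤ 1` only loses
  have g7 : r ≤ r ^ s := by
    rcases hr.eq_or_lt with h0 | h0
    · rw [← h0, Real.zero_rpow hs.ne']
    · simpa using Real.rpow_le_rpow_of_exponent_ge h0 g3 hs1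
  have g8 : |u - v| * P ≤ (K * δ ^ s) * P := by
    calc |u - v| * P = r := g2
      _ ≤ r ^ s := g7
      _ ≤ (16 * 4 ^ n * P ^ 2 * N n * δ) ^ s := by gcongr
      _ = (16 * 4 ^ n * P ^ 2 * N n) ^ s * δ ^ s := Real.mul_rpow (by positivity) hδ
      _ ≤ (K * P) * δ ^ s := by gcongr
      _ = _ := by ring
  exact le_of_mul_le_mul_right g8 hP

/-! ### Covers by cylinders that end in a large digit -/

/-- Borel–Cantelli lemma for Hausdorff measures. -/
theorem hausdorffMeasure_setOf_infinite_mem_eq_zero {ι : Type*} [Countable ι] (J : ι → Set ℝ)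
    {s : ℝ} (hs : 0 < s) (hJ : ∑' i, Metric.ediam (J i) ^ s ≠ ⊤) :
    MeasureTheory.Measure.hausdorffMeasure s {x | {i | x ∈ J i}.Infinite} = 0 := by
  have htail := ENNReal.tendsto_tsum_compl_atTop_zero hJ
  have hr : Tendsto (fun F : Finset ι => (∑' i : {i // i ∉ F}, Metric.ediam (J i) ^ s) ^ (1 / s))
      atTop (nhds 0) := by
    have := htail.ennrpow_const (1 / s)
    rwa [ENNReal.zero_rpow_of_pos (by positivity)] at this
  have h := MeasureTheory.Measure.hausdorffMeasure_le_liminf_tsum s {x | {i | x ∈ J i}.Infinite}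
    (l := atTop) (ι := fun F : Finset ι => {i // i ∉ F}) _ hr (fun F i => J i)
    (Eventually.of_forall fun F i => ?_) (Eventually.of_forall fun F x hx => ?_)
  · rw [htail.liminf_eq] at h
    exact le_antisymm h zero_le
  · rw [one_div, ENNReal.le_rpow_inv_iff hs]
    exact ENNReal.le_tsum (f := fun i : {i // i ∉ F} => Metric.ediam (J i) ^ s) i
  · obtain ⟨i, hi, hiF⟩ := Set.Infinite.exists_notMem_finset hx F
    exact Set.mem_iUnion.2 ⟨⟨i, hiF⟩, hi⟩

theorem ENNReal.tsum_pi_prod (f : ℕ → ℝ≥0∞) (n : ℕ) :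
    ∑' w : Fin n → ℕ, ∏ i, f (w i) = (∑' k, f k) ^ n := by
  induction n with
  | zero => simp
  | succ n ih =>
    rw [← (Fin.consEquiv fun _ : Fin (n + 1) => ℕ).tsum_eq, ENNReal.tsum_prod', pow_succ', ← ih,
      ← ENNReal.tsum_mul_right]
    refine tsum_congr fun k => ?_
    rw [← ENNReal.tsum_mul_left]
    refine tsum_congr fun w => ?_
    simp [Fin.prod_univ_succ]

/-- The points with first digits `w`, followed by a digit that is at least `exp L`. -/
def largeDigitCylinder {n : ℕ} (w : Fin n → ℕ) (L : ℝ) : Set ℝ :=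
  {x | ∃ a y, IsGaussOrbit a y ∧ y 0 = x ∧ (∀ i : Fin n, a i = w i) ∧ L ≤ Real.log (a n)}

theorem ediam_largeDigitCylinder_le {n : ℕ} (w : Fin n → ℕ) (L : ℝ) :
    Metric.ediam (largeDigitCylinder w L) ≤
      ENNReal.ofReal ((∏ i, (w i : ℝ) ^ (-2 : ℝ)) * Real.exp (-L)) := by
  refine Metric.ediam_le ?_
  rintro _ ⟨a, x, h, rfl, ha, hL⟩ _ ⟨a', x', h', rfl, ha', hL'⟩
  rw [edist_dist, Real.dist_eq]
  refine ENNReal.ofReal_le_ofReal ?_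
  have hprod : ∀ {b : ℕ → ℕ} {z : ℕ → ℝ}, IsGaussOrbit b z → (∀ i : Fin n, b i = w i) →
      ∏ i ∈ Finset.range n, z i ≤ ∏ i, (w i : ℝ) ^ (-1 : ℝ) := by
    intro b z hz hb
    rw [← Fin.prod_univ_eq_prod_range]
    refine Finset.prod_le_prod (fun i _ => (hz.pos _).le) fun i _ => ?_
    rw [Real.rpow_neg_one, ← hb i, ← one_div]
    exact hz.le_inv_digit i
  have hlast : ∀ {b : ℕ → ℕ} {z : ℕ → ℝ}, IsGaussOrbit b z → L ≤ Real.log (b n) →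
      z n ≤ Real.exp (-L) := by
    intro b z hz hb
    refine (hz.le_inv_digit n).trans ?_
    have h1 : (0 : ℝ) < b n := zero_lt_one.trans_le (hz.one_le_digit n)
    rw [Real.exp_neg, ← one_div]
    exact one_div_le_one_div_of_le (Real.exp_pos L) ((Real.le_log_iff_exp_le h1).1 hb)
  rw [h.abs_sub_eq_prod h' fun i hi => by rw [ha ⟨i, hi⟩, ha' ⟨i, hi⟩]]
  have h1 := hprod h ha
  have h2 := hprod h' ha'
  have h3 : |x n - x' n| ≤ Real.exp (-L) := by
    rw [abs_le]
    constructor <;> linarith [h.pos n, h'.pos n, hlast h hL, hlast h' hL']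
  have e : ∏ i, (w i : ℝ) ^ (-2 : ℝ) = (∏ i, (w i : ℝ) ^ (-1 : ℝ)) * ∏ i, (w i : ℝ) ^ (-1 : ℝ) := by
    rw [← Finset.prod_mul_distrib]
    refine Finset.prod_congr rfl fun i _ => ?_
    rw [Real.rpow_neg_one, Real.rpow_neg (Nat.cast_nonneg _), Real.rpow_ofNat, sq, mul_inv]
  rw [e]
  have := (h.prod_pos n).le
  have := (h'.prod_pos n).le
  gcongr

/-- If `s (1 + lam) > 1`, then the points for which infinitely often `a n` is at least
`(a 0 ⋯ a (n - 1)) ^ (lam - 1)`, with an exponential factor to spare, have dimension at most `s`. -/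
theorem exists_dimH_frequently_large_digit_le {s lam : ℝ} (hs : 0 < s) (hsl : 1 < s * (1 + lam)) :
    ∃ K : ℝ, 0 ≤ K ∧ dimH {x : ℝ | ∃ a y, IsGaussOrbit a y ∧ y 0 = x ∧ ∃ᶠ n : ℕ in atTop,
      K * n + (lam - 1) * ∑ j ∈ Finset.range n, Real.log (a j) ≤ Real.log (a n)} ≤
        ENNReal.ofReal s := by
  set σ := s * (1 + lam) with hσ
  set f : ℕ → ℝ≥0∞ := fun k => ENNReal.ofReal ((k : ℝ) ^ (-σ)) with hf
  have hsum : Summable fun k : ℕ => (k : ℝ) ^ (-σ) := Real.summable_nat_rpow.2 (by linarith)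
  set Z : ℝ := ∑' k : ℕ, (k : ℝ) ^ (-σ) with hZ
  have hZ0 : 0 ≤ Z := tsum_nonneg fun k => by positivity
  have hfZ : ∑' k, f k = ENNReal.ofReal Z :=
    (ENNReal.ofReal_tsum_of_nonneg (fun k => by positivity) hsum).symm
  -- chosen such that `exp (-(s * K)) * Z < 1`, for the sum over all cylinders to be geometric
  set K : ℝ := Real.log (Z + 1) / s with hK
  have hK0 : 0 ≤ K := div_nonneg (Real.log_nonneg (by linarith)) hs.le
  refine ⟨K, hK0, ?_⟩
  let L : (Σ n : ℕ, Fin n → ℕ) → ℝ := fun p =>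
    K * p.1 + (lam - 1) * ∑ j, Real.log (p.2 j)
  let J : (Σ n : ℕ, Fin n → ℕ) → Set ℝ := fun p => largeDigitCylinder p.2 (L p)
  have hdiam : ∀ p, Metric.ediam (J p) ^ s ≤
      ENNReal.ofReal (1 / (Z + 1)) ^ p.1 * ∏ i, f (p.2 i) := by
    rintro ⟨n, w⟩
    by_cases hw : ∀ i, 1 ≤ w i
    · have hwpos : ∀ i, (0 : ℝ) < w i := fun i => by exact_mod_cast hw i
      calc Metric.ediam (J ⟨n, w⟩) ^ s
          ≤ ENNReal.ofReal ((∏ i, (w i : ℝ) ^ (-2 : ℝ)) * Real.exp (-L ⟨n, w⟩)) ^ s := by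
            gcongr
            exact ediam_largeDigitCylinder_le w _
        _ = ENNReal.ofReal ((1 / (Z + 1)) ^ n * ∏ i, (w i : ℝ) ^ (-σ)) := by
            rw [ENNReal.ofReal_rpow_of_nonneg (mul_nonneg (Finset.prod_nonneg fun i _ =>
              Real.rpow_nonneg (hwpos i).le _) (Real.exp_pos _).le) hs.le]
            congr 1
            have e1 : ∀ τ : ℝ, ∏ i, (w i : ℝ) ^ τ = Real.exp (τ * ∑ i, Real.log (w i)) := by
              intro τ
              rw [Finset.mul_sum, Real.exp_sum]
              refine Finset.prod_congr rfl fun i _ => ?_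
              rw [Real.rpow_def_of_pos (hwpos i), mul_comm]
            have e2 : (1 / (Z + 1)) ^ n = Real.exp (-(s * K * n)) := by
              rw [hK, mul_div_cancel₀ _ hs.ne', mul_comm, ← mul_neg, ← Real.log_inv,
                Real.exp_nat_mul, Real.exp_log (by positivity), one_div]
            rw [e1, e1, e2, ← Real.exp_add, ← Real.exp_add, ← Real.exp_mul]
            congr 1
            simp only [L, hσ]
            ring
        _ = ENNReal.ofReal (1 / (Z + 1)) ^ n * ∏ i, f (w i) := by
            rw [ENNReal.ofReal_mul (by positivity), ENNReal.ofReal_pow (by positivity),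
              ENNReal.ofReal_prod_of_nonneg fun i _ => by positivity]
    · -- no continued fraction has a digit `0`
      have hempty : J ⟨n, w⟩ = ∅ := by
        refine Set.eq_empty_of_forall_notMem ?_
        rintro _ ⟨a, x, h, rfl, ha, -⟩
        exact hw fun i => (h.digit_pos i).trans_eq (ha i)
      rw [hempty, Metric.ediam_empty, ENNReal.zero_rpow_of_pos hs]
      exact zero_le
  have hfin : ∑' p, Metric.ediam (J p) ^ s ≠ ⊤ := by
    refine ne_top_of_le_ne_top ?_ (ENNReal.tsum_le_tsum hdiam)
    rw [ENNReal.tsum_sigma']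
    simp_rw [ENNReal.tsum_mul_left, ENNReal.tsum_pi_prod, hfZ, ← mul_pow]
    rw [ENNReal.tsum_geometric, ← ENNReal.ofReal_mul (by positivity)]
    refine ENNReal.inv_ne_top.2 (tsub_pos_of_lt ?_).ne'
    rw [ENNReal.ofReal_lt_one, one_div_mul_eq_div, div_lt_one (by linarith)]
    linarith
  have hzero := hausdorffMeasure_setOf_infinite_mem_eq_zero J hs hfin
  rw [← Real.coe_toNNReal s hs.le] at hzero
  refine (dimH_mono ?_).trans (dimH_le_of_hausdorffMeasure_ne_top
    (hzero ▸ ENNReal.zero_ne_top))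
  rintro _ ⟨a, x, h, rfl, hx⟩
  have hinf := Nat.frequently_atTop_iff_infinite.1 hx
  let g : ℕ → Σ n : ℕ, Fin n → ℕ := fun n => ⟨n, fun i => a i⟩
  have hg : Function.Injective g := fun n k hnk => congrArg Sigma.fst hnk
  refine (hinf.image hg.injOn).mono ?_
  rintro _ ⟨n, hn, rfl⟩
  refine ⟨a, x, h, rfl, fun i => rfl, ?_⟩
  simp only [L, g]
  rw [Fin.sum_univ_eq_sum_range fun j => Real.log (a j)]
  exact hn

/-- A sequence that exceeds `c ^ n` infinitely often, `c > lam`, must grow by a factor of at least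
`lam` (and more than linearly) infinitely often. -/
theorem frequently_mul_add_le_of_pow_le {b : ℕ → ℝ} (hb : ∀ n, 0 ≤ b n) {lam c : ℝ}
    (hlam : 1 ≤ lam) (hc : lam < c) (h : ∃ᶠ n : ℕ in atTop, c ^ (n + 1) ≤ b n) (K : ℝ) :
    ∃ᶠ n : ℕ in atTop, K * n + (lam - 1) * ∑ j ∈ Finset.range n, b j ≤ b n := by
  by_contra hnot
  obtain ⟨k₀, hk₀⟩ := eventually_atTop.1 (not_frequently.1 hnot)
  -- otherwise the partial sums are `O (d ^ n)` for any `d` between `lam` and `c`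
  obtain ⟨d, hd1, hd2⟩ := exists_between hc
  have hd : 1 < d := hlam.trans_lt hd1
  obtain ⟨K₀, hK₀⟩ := exists_mul_le_pow_add hd K
  have hdl : 0 < d - lam := sub_pos.2 hd1
  set Q : ℕ → ℝ := fun n => ∑ j ∈ Finset.range n, b j with hQ
  have hQ0 : ∀ n, 0 ≤ Q n := fun n => Finset.sum_nonneg fun j _ => hb j
  set M : ℝ := (1 + |K₀|) / (d - lam) + Q k₀ with hM
  have hgrow : ∀ n, k₀ ≤ n → Q n ≤ M * d ^ n := by
    intro n hn
    induction n, hn using Nat.le_induction with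
    | base =>
      have h1 : 1 ≤ d ^ k₀ := one_le_pow₀ hd.le
      have h2 : 0 ≤ (1 + |K₀|) / (d - lam) := by positivity
      have := hQ0 k₀
      calc Q k₀ ≤ M * 1 := by linarith
        _ ≤ M * d ^ k₀ := by gcongr
    | succ n hn ih =>
      have h1 := hk₀ n hn
      rw [not_le] at h1
      have h2 : Q (n + 1) = Q n + b n := Finset.sum_range_succ _ _
      have h3 : 1 ≤ d ^ n := one_le_pow₀ hd.le
      have h4 : (1 + |K₀|) ≤ M * (d - lam) := by
        rw [hM, add_mul, div_mul_cancel₀ _ hdl.ne']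
        have := mul_nonneg (hQ0 k₀) hdl.le
        linarith
      have h5 : K * n ≤ (1 + |K₀|) * d ^ n := by
        have := hK₀ n
        have := le_abs_self K₀
        nlinarith [abs_nonneg K₀]
      have h6 : (1 + |K₀|) * d ^ n ≤ M * (d - lam) * d ^ n := by gcongr
      have h7 : lam * Q n ≤ lam * (M * d ^ n) := by gcongr
      rw [pow_succ, h2]
      linarith
  have hlim : Tendsto (fun n : ℕ => M * (d / c) ^ (n + 1)) atTop (nhds 0) := by
    have hc0 : 0 < c := by linarith
    have := ((tendsto_pow_atTop_nhds_zero_of_lt_one (div_nonneg (by linarith) hc0.le)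
      ((div_lt_one hc0).2 hd2)).comp (tendsto_add_atTop_nat 1)).const_mul M
    simpa using this
  obtain ⟨n, hn1, hn2, hn3⟩ :=
    (h.and_eventually ((hlim.eventually_lt_const one_pos).and (eventually_ge_atTop k₀))).exists
  have h1 := hgrow (n + 1) (by omega)
  have h2 : Q (n + 1) = Q n + b n := Finset.sum_range_succ _ _
  have h3 := hQ0 n
  have hc0 : 0 < c ^ (n + 1) := pow_pos (by linarith) _
  rw [div_pow, ← mul_div_assoc, div_lt_one hc0] at hn2
  linarith

section WeightedProduct

variable {m : ℕ} {t : Fin m → ℝ} {Ψ : ℕ → ℝ}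

/-- Products with a non-existent partial quotient vanish, so the points of the set have infinite
expansions. -/
theorem exists_isGaussOrbit_of_mem (hm : 1 ≤ m) (ht : ∀ i, 0 < t i)
    (hΨ : ∀ n : ℕ, 1 ≤ n → 1 ≤ Ψ n) {x : ℝ} (hx : x ∈ weightedProductSet t Ψ) :
    ∃ a y, IsGaussOrbit a y ∧ y 0 = x ∧ ∃ᶠ n : ℕ in atTop,
      Ψ (n + 1) ≤ ∏ i : Fin m, (a (n + i) : ℝ) ^ t i := by
  obtain ⟨hxI, hinf⟩ := hx
  have hne : ∀ n, gaussMap^[n] x ≠ 0 := by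
    intro k hk
    have hzero : ∀ j, k ≤ j → gaussMap^[j] x = 0 := by
      intro j hj
      induction j, hj using Nat.le_induction with
      | base => exact hk
      | succ j _ ih => rw [Function.iterate_succ_apply', ih, gaussMap, div_zero, Int.fract_zero]
    obtain ⟨n, ⟨hn1, hn2⟩, hkn⟩ := hinf.exists_gt k
    have hq : partialQuotient (n + (⟨0, hm⟩ : Fin m)) x = 0 := by
      rw [partialQuotient, hzero _ (by simp only; omega), div_zero, Nat.floor_zero]
    rw [Finset.prod_eq_zero (Finset.mem_univ (⟨0, hm⟩ : Fin m))
      (by rw [hq, Nat.cast_zero, Real.zero_rpow (ht _).ne'])] at hn2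
    linarith [hΨ n hn1]
  refine ⟨_, _, isGaussOrbit_of_iterate_ne_zero hxI hne, rfl, ?_⟩
  rw [frequently_atTop]
  intro N
  obtain ⟨n, ⟨hn1, hn2⟩, hNn⟩ := hinf.exists_gt N
  obtain ⟨k, rfl⟩ := Nat.exists_eq_add_of_le' hn1
  refine ⟨k, by omega, ?_⟩
  simpa only [add_right_comm] using hn2

/-- If the weighted products of `m` consecutive digits are large infinitely often, then so is a
single digit. -/
theorem frequently_le_log_digit (hm : 1 ≤ m) (ht : ∀ i, 0 < t i) (hΨ : ∀ n : ℕ, 1 ≤ n → 1 ≤ Ψ n)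
    {a : ℕ → ℕ} (ha : ∀ n, 1 ≤ a n)
    (h : ∃ᶠ n : ℕ in atTop, Ψ (n + 1) ≤ ∏ i : Fin m, (a (n + i) : ℝ) ^ t i) {H : ℕ → ℝ}
    (hH : ∀ᶠ n : ℕ in atTop, ∀ i < m, (∑ i, t i) * H (n + i) ≤ Real.log (Ψ n)) :
    ∃ᶠ n : ℕ in atTop, H (n + 1) ≤ Real.log (a n) := by
  rw [frequently_atTop]
  intro N
  obtain ⟨n, hn1, hn2, hn3⟩ := (h.and_eventually
    (((tendsto_add_atTop_nat 1).eventually hH).and (eventually_ge_atTop N))).exists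
  have hapos : ∀ n, (0 : ℝ) < a n := fun n => by exact_mod_cast ha n
  have hlog := Real.log_le_log (by linarith [hΨ (n + 1) (by omega)]) hn1
  rw [Real.log_prod fun i _ => (Real.rpow_pos_of_pos (hapos _) _).ne'] at hlog
  simp_rw [Real.log_rpow (hapos _)] at hlog
  by_contra! hall
  have hlt : ∑ i : Fin m, t i * Real.log (a (n + i)) < ∑ i : Fin m, t i * (Real.log (Ψ (n + 1)) /
      ∑ i, t i) := by
    have : Nonempty (Fin m) := ⟨⟨0, hm⟩⟩
    have hτ : 0 < ∑ i, t i := Finset.sum_pos (fun i _ => ht i) Finset.univ_nonempty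
    refine Finset.sum_lt_sum_of_nonempty Finset.univ_nonempty fun i _ => ?_
    have h1 := hall (n + i) (by omega)
    have h2 := hn2 i i.2
    rw [add_right_comm] at h2
    refine mul_lt_mul_of_pos_left (h1.trans_le ?_) (ht i)
    rw [le_div_iff₀ hτ]
    linarith
  have hτ : 0 < ∑ i, t i :=
    Finset.sum_pos (fun i _ => ht i) (Finset.univ_nonempty_iff.2 ⟨⟨0, hm⟩⟩)
  rw [← Finset.sum_mul, mul_div_cancel₀ _ hτ.ne'] at hlt
  linarith

theorem dimH_weightedProductSet_le_of_half_lt (hm : 1 ≤ m) (ht : ∀ i, 0 < t i)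
    (hΨ : ∀ n : ℕ, 1 ≤ n → 1 ≤ Ψ n) (hlin : ∀ K : ℝ, ∀ᶠ n : ℕ in atTop, K * n ≤ Real.log (Ψ n))
    {s : ℝ} (hs : 1 / 2 < s) : dimH (weightedProductSet t Ψ) ≤ ENNReal.ofReal s := by
  obtain ⟨K, hK0, hK⟩ := exists_dimH_frequently_large_digit_le (s := s) (lam := 1) (by linarith)
    (by linarith)
  refine (dimH_mono fun x hx => ?_).trans hK
  obtain ⟨a, y, hy, hyx, hfreq⟩ := exists_isGaussOrbit_of_mem hm ht hΨ hx
  have hτ : 0 ≤ ∑ i, t i := Finset.sum_nonneg fun i _ => (ht i).le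
  refine ⟨a, y, hy, hyx, ?_⟩
  refine (frequently_le_log_digit hm ht hΨ hy.digit_pos hfreq (H := fun k => K * k) ?_).mono
    fun n hn => ?_
  · filter_upwards [hlin ((∑ i, t i) * (K * 2)), eventually_ge_atTop m] with n hn hnm i hi
    refine le_trans ?_ hn
    have : ((n + i : ℕ) : ℝ) ≤ 2 * n := by exact_mod_cast (by omega : n + i ≤ 2 * n)
    calc (∑ i, t i) * (K * (n + i : ℕ)) ≤ (∑ i, t i) * (K * (2 * n)) := by gcongr
      _ = _ := by ring
  · push_cast at hn
    linarith

theorem dimH_weightedProductSet_le_of_pow_le (hm : 1 ≤ m) (ht : ∀ i, 0 < t i)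
    (hΨ : ∀ n : ℕ, 1 ≤ n → 1 ≤ Ψ n) {d : ℝ} (hd : 1 < d)
    (hpow : ∀ᶠ n : ℕ in atTop, d ^ n ≤ Real.log (Ψ n)) {s : ℝ} (hs : 0 < s)
    (hsd : 1 < s * (1 + d)) : dimH (weightedProductSet t Ψ) ≤ ENNReal.ofReal s := by
  -- `1 / s - 1 < lam` is the condition `1 < s * (1 + lam)` for the covers
  have hlt : max 1 (1 / s - 1) < d := by
    refine max_lt hd ?_
    rw [sub_lt_iff_lt_add, div_lt_iff₀ hs]
    linarith
  obtain ⟨lam, hlam1, hlam2⟩ := exists_between hlt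
  obtain ⟨c, hc1, hc2⟩ := exists_between hlam2
  have hlam : 1 < lam := (le_max_left _ _).trans_lt hlam1
  have hsl : 1 < s * (1 + lam) := by
    have := (le_max_right _ _).trans_lt hlam1
    rw [sub_lt_iff_lt_add, div_lt_iff₀ hs] at this
    linarith
  obtain ⟨K, -, hK⟩ := exists_dimH_frequently_large_digit_le hs hsl
  refine (dimH_mono fun x hx => ?_).trans hK
  obtain ⟨a, y, hy, hyx, hfreq⟩ := exists_isGaussOrbit_of_mem hm ht hΨ hx
  have hτ : 0 ≤ ∑ i, t i := Finset.sum_nonneg fun i _ => (ht i).le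
  refine ⟨a, y, hy, hyx, frequently_mul_add_le_of_pow_le
    (fun n => Real.log_nonneg (hy.one_le_digit n)) hlam.le hc1 ?_ K⟩
  refine frequently_le_log_digit hm ht hΨ hy.digit_pos hfreq (H := fun k => c ^ k) ?_
  have hlim : Tendsto (fun n : ℕ => (∑ i, t i) * c ^ m * (c / d) ^ n) atTop (nhds 0) := by
    simpa using (tendsto_pow_atTop_nhds_zero_of_lt_one (div_nonneg (by linarith) (by linarith))
      ((div_lt_one (by linarith)).2 hc2)).const_mul ((∑ i, t i) * c ^ m)
  filter_upwards [hlim.eventually_le_const one_pos, hpow] with n h1 h2 i hi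
  refine le_trans ?_ h2
  have hdn : 0 < d ^ n := by positivity
  rw [div_pow, ← mul_div_assoc, div_le_one hdn] at h1
  have h3 : c ^ i ≤ c ^ m := pow_le_pow_right₀ (by linarith) hi.le
  have h4 : 0 < c ^ n := pow_pos (by linarith) _
  calc (∑ i, t i) * c ^ (n + i) = (∑ i, t i) * c ^ i * c ^ n := by ring
    _ ≤ (∑ i, t i) * c ^ m * c ^ n := by gcongr
    _ ≤ d ^ n := h1

end WeightedProduct

/-! ### Growth rates and the dimension of the weighted product set -/

section WeightedProductSet

variable {m : ℕ} {t : Fin m → ℝ} {Ψ : ℕ → ℝ}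

theorem frequently_atTop_add_one {p : ℕ → Prop} (h : ∃ᶠ n in atTop, p n) :
    ∃ᶠ n in atTop, p (n + 1) := by
  rw [← map_add_atTop_eq_nat 1] at h
  exact frequently_map.1 h

/-- For a point with an infinite expansion, the first factor bounds the weighted product. -/
theorem mem_weightedProductSet_of_frequently (hm : 1 ≤ m) (ht : ∀ i, 0 < t i)
    (hΨ : ∀ n : ℕ, 1 ≤ n → 1 ≤ Ψ n) {x : ℝ} (hx : x ∈ Set.Ico (0 : ℝ) 1)
    (hpos : ∀ n, 1 ≤ partialQuotient (n + 1) x)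
    (h : ∃ᶠ n : ℕ in atTop,
      Real.exp (Real.log (Ψ (n + 1)) / t ⟨0, hm⟩) ≤ partialQuotient (n + 1) x) :
    x ∈ weightedProductSet t Ψ := by
  refine ⟨hx, ?_⟩
  have hinf := Nat.frequently_atTop_iff_infinite.1 h
  refine (hinf.image (add_left_injective 1).injOn).mono ?_
  rintro _ ⟨n, hn, rfl⟩
  refine ⟨Nat.le_add_left 1 n, ?_⟩
  have hΨpos : 0 < Ψ (n + 1) := by linarith [hΨ (n + 1) (by omega)]
  have ht0 := ht ⟨0, hm⟩
  have h1 : Ψ (n + 1) ≤ (partialQuotient (n + 1 + (⟨0, hm⟩ : Fin m)) x : ℝ) ^ t ⟨0, hm⟩ := by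
    calc Ψ (n + 1) = Real.exp (Real.log (Ψ (n + 1)) / t ⟨0, hm⟩) ^ t ⟨0, hm⟩ := by
          rw [← Real.exp_mul, div_mul_cancel₀ _ ht0.ne', Real.exp_log hΨpos]
      _ ≤ (partialQuotient (n + 1) x : ℝ) ^ t ⟨0, hm⟩ :=
          Real.rpow_le_rpow (Real.exp_pos _).le hn ht0.le
  have h2 : ∀ i : Fin m, 1 ≤ (partialQuotient (n + 1 + i) x : ℝ) ^ t i := fun i => by
    refine Real.one_le_rpow ?_ (ht i).le
    have := hpos (n + i)
    rw [add_right_comm] at this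
    exact_mod_cast this
  rw [← Finset.mul_prod_erase _ _ (Finset.mem_univ (⟨0, hm⟩ : Fin m))]
  refine h1.trans (le_mul_of_one_le_right (zero_le_one.trans (h2 _)) ?_)
  simpa using Finset.prod_le_prod (s := Finset.univ.erase (⟨0, hm⟩ : Fin m))
    (f := fun _ => (1 : ℝ)) (fun _ _ => zero_le_one) fun i _ => h2 i

theorem frequently_log_le_of_expGrowth_eq_one (h : expGrowth Ψ = 1) {ε : ℝ} (hε : 0 < ε) :
    ∃ᶠ n : ℕ in atTop, Real.log (Ψ n) ≤ ε * n := by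
  rw [expGrowth] at h
  have h0 : liminf (fun n : ℕ => ((Real.log (Ψ n) / n : ℝ) : EReal)) atTop < (ε : EReal) :=
    (EReal.exp_le_one_iff.1 h.le).trans_lt (by exact_mod_cast hε)
  refine ((frequently_lt_of_liminf_lt isCobounded_ge_of_top h0).and_eventually
    (eventually_gt_atTop 0)).mono fun n ⟨hn, hn0⟩ => ?_
  have hn' : (0 : ℝ) < n := by exact_mod_cast hn0
  exact ((div_lt_iff₀ hn').1 (EReal.coe_lt_coe_iff.1 hn)).le

theorem eventually_le_log_of_expGrowth_eq_top (h : expGrowth Ψ = ⊤) (K : ℝ) :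
    ∀ᶠ n : ℕ in atTop, K * n ≤ Real.log (Ψ n) := by
  rw [expGrowth, EReal.exp_eq_top_iff] at h
  have h0 : (K : EReal) < liminf (fun n : ℕ => ((Real.log (Ψ n) / n : ℝ) : EReal)) atTop := by
    rw [h]
    exact EReal.coe_lt_top K
  filter_upwards [eventually_lt_of_lt_liminf h0, eventually_gt_atTop 0] with n hn hn0
  have hn' : (0 : ℝ) < n := by exact_mod_cast hn0
  exact ((lt_div_iff₀ hn').1 (EReal.coe_lt_coe_iff.1 hn)).le

theorem eventually_one_le_log_of_expGrowth_eq_top (h : expGrowth Ψ = ⊤) :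
    ∀ᶠ n : ℕ in atTop, 0 < n ∧ 1 ≤ Real.log (Ψ n) := by
  filter_upwards [eventually_le_log_of_expGrowth_eq_top h 1, eventually_gt_atTop 0] with n hn hn0
  have hn' : (1 : ℝ) ≤ n := by exact_mod_cast hn0
  exact ⟨hn0, by linarith⟩

theorem log_log_div_eq {n : ℕ} (h : 1 ≤ Real.log (Ψ n)) :
    ENNReal.log (ENNReal.ofReal (Real.log (Ψ n))) / (n : EReal) =
      ((Real.log (Real.log (Ψ n)) / n : ℝ) : EReal) := by
  rw [ENNReal.log_ofReal_of_pos (by linarith), EReal.coe_div]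
  rfl

theorem one_le_doubleExpGrowth (h : expGrowth Ψ = ⊤) : 1 ≤ doubleExpGrowth Ψ := by
  rw [doubleExpGrowth, EReal.one_le_exp_iff]
  refine le_liminf_of_le isCobounded_ge_of_top ?_
  filter_upwards [eventually_one_le_log_of_expGrowth_eq_top h] with n hn
  rw [log_log_div_eq hn.2]
  exact_mod_cast div_nonneg (Real.log_nonneg hn.2) (Nat.cast_nonneg n)

theorem eventually_pow_le_log (h : expGrowth Ψ = ⊤) {d : ℝ} (hd : 0 < d)
    (hb : ENNReal.ofReal d < doubleExpGrowth Ψ) :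
    ∀ᶠ n : ℕ in atTop, d ^ n ≤ Real.log (Ψ n) := by
  rw [doubleExpGrowth, ← Real.exp_log hd, ← EReal.exp_coe, EReal.exp_lt_exp_iff] at hb
  filter_upwards [eventually_one_le_log_of_expGrowth_eq_top h, eventually_lt_of_lt_liminf hb]
    with n ⟨hn0, hn1⟩ hn
  have hn' : (0 : ℝ) < n := by exact_mod_cast hn0
  rw [log_log_div_eq hn1, EReal.coe_lt_coe_iff, lt_div_iff₀ hn', mul_comm, ← Real.log_pow] at hn
  exact ((Real.log_lt_log_iff (by positivity) (by linarith)).1 hn).le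

theorem frequently_log_le_pow (h : expGrowth Ψ = ⊤) {c : ℝ} (hc : 0 < c)
    (hb : doubleExpGrowth Ψ < ENNReal.ofReal c) :
    ∃ᶠ n : ℕ in atTop, Real.log (Ψ n) ≤ c ^ n := by
  rw [doubleExpGrowth, ← Real.exp_log hc, ← EReal.exp_coe, EReal.exp_lt_exp_iff] at hb
  refine ((frequently_lt_of_liminf_lt isCobounded_ge_of_top hb).and_eventually
    (eventually_one_le_log_of_expGrowth_eq_top h)).mono fun n ⟨hn, hn0, hn1⟩ => ?_
  have hn' : (0 : ℝ) < n := by exact_mod_cast hn0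
  rw [log_log_div_eq hn1, EReal.coe_lt_coe_iff, div_lt_iff₀ hn', mul_comm, ← Real.log_pow] at hn
  exact ((Real.log_lt_log_iff (by linarith) (by positivity)).1 hn).le

theorem dimH_weightedProductSet_eq_one (hm : 1 ≤ m) (ht : ∀ i, 0 < t i)
    (hΨ : ∀ n : ℕ, 1 ≤ n → 1 ≤ Ψ n) (h : expGrowth Ψ = 1) : dimH (weightedProductSet t Ψ) = 1 := by
  refine le_antisymm ((dimH_mono (Set.subset_univ _)).trans_eq Real.dimH_univ) ?_
  have ht0 := ht ⟨0, hm⟩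
  refine (one_le_dimH_frequently_le_digit
    (Φ := fun n => Real.exp (Real.log (Ψ (n + 1)) / t ⟨0, hm⟩)) fun ε hε => ?_).trans
    (dimH_mono fun x hx => mem_weightedProductSet_of_frequently hm ht hΨ hx.1 hx.2.1 hx.2.2)
  have hfreq := frequently_atTop_add_one
    (frequently_log_le_of_expGrowth_eq_one h (ε := ε * t ⟨0, hm⟩ / 2) (by positivity))
  refine (hfreq.and_eventually (eventually_ge_atTop 1)).mono fun n ⟨hn, hn1⟩ => ?_
  refine Real.exp_le_exp.2 ((div_le_iff₀ ht0).2 (hn.trans ?_))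
  have h1 : ((n + 1 : ℕ) : ℝ) ≤ 2 * n := by exact_mod_cast (by omega : n + 1 ≤ 2 * n)
  calc ε * t ⟨0, hm⟩ / 2 * (n + 1 : ℕ) ≤ ε * t ⟨0, hm⟩ / 2 * (2 * n) := by gcongr
    _ = _ := by ring

theorem le_dimH_weightedProductSet (hm : 1 ≤ m) (ht : ∀ i, 0 < t i)
    (hΨ : ∀ n : ℕ, 1 ≤ n → 1 ≤ Ψ n) (h : expGrowth Ψ = ⊤) {b s : ℝ} (hb1 : 1 ≤ b)
    (hb : doubleExpGrowth Ψ = ENNReal.ofReal b) (hs : 0 < s) (hsb : s * (1 + b) < 1) :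
    ENNReal.ofReal s ≤ dimH (weightedProductSet t Ψ) := by
  have hlt : b < 1 / s - 1 := by
    rw [lt_sub_iff_add_lt, lt_div_iff₀ hs]
    linarith
  -- the room between `c'` and `c` absorbs the weight `t 0`
  obtain ⟨c, hbc, hcs⟩ := exists_between hlt
  obtain ⟨c', hbc', hcc'⟩ := exists_between hbc
  have hsc : s * (1 + c) < 1 := by
    rw [lt_sub_iff_add_lt, lt_div_iff₀ hs] at hcs
    linarith
  have ht0 := ht ⟨0, hm⟩
  refine (le_dimH_exp_pow_le_digit (by linarith) hs hsc).trans (dimH_mono ?_)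
  rintro x ⟨hx, hx'⟩
  refine mem_weightedProductSet_of_frequently hm ht hΨ hx (fun n => ?_) ?_
  · exact_mod_cast (Real.exp_pos _).trans_le (hx' n)
  · have hfreq := frequently_log_le_pow h (c := c') (by linarith)
      (by rw [hb]; exact (ENNReal.ofReal_lt_ofReal_iff (by linarith)).2 hbc')
    have hlim := tendsto_pow_atTop_nhds_zero_of_lt_one
      (div_nonneg (by linarith : 0 ≤ c') (by linarith : 0 ≤ c)) ((div_lt_one (by linarith)).2 hcc')
    refine (frequently_atTop_add_one
      (hfreq.and_eventually (hlim.eventually_le_const ht0))).mono fun n ⟨hn1, hn2⟩ => ?_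
    refine (Real.exp_le_exp.2 ((div_le_iff₀ ht0).2 (hn1.trans ?_))).trans (hx' n)
    rwa [div_pow, div_le_iff₀ (pow_pos (by linarith) _), mul_comm] at hn2

theorem dimH_weightedProductSet_eq_one_div (hm : 1 ≤ m) (ht : ∀ i, 0 < t i)
    (hΨ : ∀ n : ℕ, 1 ≤ n → 1 ≤ Ψ n) (h : expGrowth Ψ = ⊤) :
    dimH (weightedProductSet t Ψ) = 1 / (1 + doubleExpGrowth Ψ) := by
  have hb1 := one_le_doubleExpGrowth h
  refine le_antisymm (le_of_forall_gt_imp_ge_of_dense fun r hr => ?_)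
    (le_of_forall_lt_imp_le_of_dense fun r hr => ?_)
  · induction r with
    | top => exact le_top
    | coe s =>
      have hs : 0 < s := by
        have : (0 : ℝ≥0∞) < s := hr.bot_lt
        exact_mod_cast this
      rw [← ENNReal.ofReal_coe_nnreal]
      rcases lt_or_ge (1 / 2 : ℝ) s with hs2 | hs2
      · exact dimH_weightedProductSet_le_of_half_lt hm ht hΨ
          (eventually_le_log_of_expGrowth_eq_top h) hs2
      have hs' : (0 : ℝ) < s := hs
      have hs1 : (1 : ℝ) ≤ 1 / s - 1 := by
        rw [le_sub_iff_add_le, le_div_iff₀ hs']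
        linarith
      have hlt : ENNReal.ofReal (1 / s - 1) < doubleExpGrowth Ψ := by
        rw [one_div, ENNReal.inv_lt_iff_inv_lt] at hr
        have e : (s : ℝ≥0∞)⁻¹ = 1 + ENNReal.ofReal (1 / s - 1) := by
          rw [← ENNReal.ofReal_one, ← ENNReal.ofReal_add zero_le_one (by linarith),
            add_sub_cancel, one_div, ENNReal.ofReal_inv_of_pos hs', ENNReal.ofReal_coe_nnreal]
        rw [e] at hr
        exact lt_of_add_lt_add_left hr
      obtain ⟨d, hd1, hd2⟩ := ENNReal.lt_iff_exists_nnreal_btwn.1 hlt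
      rw [← ENNReal.ofReal_coe_nnreal] at hd1 hd2
      have hd : 1 / (s : ℝ) - 1 < d := ((ENNReal.ofReal_lt_ofReal_iff_of_nonneg (by linarith)).1 hd1)
      refine dimH_weightedProductSet_le_of_pow_le hm ht hΨ (by linarith)
        (eventually_pow_le_log h (by linarith) hd2) hs' ?_
      rw [sub_lt_iff_lt_add, div_lt_iff₀ hs'] at hd
      linarith
  · rcases eq_or_ne (doubleExpGrowth Ψ) ⊤ with htop | htop
    · simp [htop] at hr
    have hbeq : doubleExpGrowth Ψ = ENNReal.ofReal (doubleExpGrowth Ψ).toReal :=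
      (ENNReal.ofReal_toReal htop).symm
    have hb1' : 1 ≤ (doubleExpGrowth Ψ).toReal := by
      simpa using ENNReal.toReal_mono htop hb1
    set b := (doubleExpGrowth Ψ).toReal
    rcases eq_or_ne r 0 with rfl | hr0
    · exact zero_le
    lift r to NNReal using hr.ne_top
    have hr0' : (0 : ℝ) < r := by
      have : (0 : NNReal) < r := pos_iff_ne_zero.2 (by exact_mod_cast hr0)
      exact this
    rw [← ENNReal.ofReal_coe_nnreal]
    refine le_dimH_weightedProductSet hm ht hΨ h hb1' hbeq hr0' ?_
    rw [hbeq, ← ENNReal.ofReal_one, ← ENNReal.ofReal_add zero_le_one (by linarith),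
      ← ENNReal.ofReal_div_of_pos (by linarith), ← ENNReal.ofReal_coe_nnreal,
      ENNReal.ofReal_lt_ofReal_iff_of_nonneg hr0'.le, lt_div_iff₀ (by linarith)] at hr
    exact hr

end WeightedProductSet

theorem theorem1p5 (m : ℕ) (hm : 1 ≤ m) (t : Fin m → ℝ) (ht : ∀ i, 0 < t i)
    (Ψ : ℕ → ℝ) (hΨ : ∀ n : ℕ, 1 ≤ n → 1 ≤ Ψ n) :
    (expGrowth Ψ = 1 → dimH (weightedProductSet t Ψ) = 1) ∧
    (expGrowth Ψ = ⊤ → dimH (weightedProductSet t Ψ) = 1 / (1 + doubleExpGrowth Ψ)) :=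
  ⟨dimH_weightedProductSet_eq_one hm ht hΨ, dimH_weightedProductSet_eq_one_div hm ht hΨ⟩
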